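/- Let $M$ be a compact smooth Riemannian manifold (without boundary) and let $\mathcal U=\{U_1,\dots,U_N\}$ be a finite open cover of $M$. For a tuple of indices $I=(i_0,\dots,i_{s-1})$ put $U_I=U_{i_0}\cap\dots\cap U_{i_{s-1}}$, with $U_\emptyset=M$ for $s=0$. For $r,s\ge 0$ let $$K^{r,s}=\bigoplus_{i_0<\dots<i_{s-1}}\Omega^r(U_I),\qquad K^{r,0}=\Omega^r(M),$$ where $\Omega^r(U)$ is the space of smooth $r$-forms on $U$. Define $\delta:K^{r,s}\to K^{r,s+1}$ by $$(\delta\alpha)_J=\sum_{t=0}^{s}(-1)^t\,\alpha_{j_0\dots\widehat{j_t}\dots j_s}\big|_{U_J},\qquad J=(j_0<\dots<j_s),$$ let $d$ act on each component, and put $\|\alpha\|_{L^p(K^{r,s})}=\sum_{i_0<\dots<i_{s-1}}\|\alpha_I\|_{L^p(U_I)}\in[0,\infty]$, where $\|\omega\|_{L^p(U)}=\left(\int_U|\omega|^p\,d\mathrm{Vol}\right)^{1/p}$, with the pointwise norm and the volume given by the Riemannian metric. For an arbitrary tuple $J$ of indices, $\alpha_J$ is defined by antisymmetry in the indices (in particular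 it is $0$ if an index is repeated). Then for every $r\ge 0$: (i) $\delta^2=0$, i.e. $(K^{r,\bullet},\delta)$ is a complex. (ii) The complex $0\to K^{r,0}\to K^{r,1}\to K^{r,2}\to\cdots$ is exact. Moreover, for every $s\ge 0$ and every real $p\ge 1$ there is a finite constant $C$ such that every $\beta\in K^{r,s+1}$ with $\delta\beta=0$ has a primitive $\alpha\in K^{r,s}$, $\delta\alpha=\beta$, with $$\|\alpha\|_{L^p(K^{r,s})}\le C\,\|\beta\|_{L^p(K^{r,s+1})},\qquad \|d\alpha\|_{L^p(K^{r+1,s})}\le C\left(\|\beta\|_{L^p(K^{r,s+1})}+\|d\beta\|_{L^p(K^{r+1,s+1})}\right).$$ (iii) Such primitives are obtained from partitions of unity: let $(\rho_j)_{j=1}^N$ be a smooth partition of unity with $\operatorname{supp}\rho_j\subset U_j$, let $s\ge0$ and $p\ge1$. Then there is a finite constant $C$ such that for every $\beta\in K^{r,s+1}$ with $\delta\beta=0$ the family $$\alpha_{i_0\dots i_{s-1}}=\sum_{j=1}^N\rho_j\,\beta_{j,i_0,\dots,i_{s-1}}$$ (each summand extended by zero from $U_j\cap U_I$ to $U_I$)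 belongs to $K^{r,s}$, satisfies $\delta\alpha=\beta$, and satisfies the two estimates of (ii) with this $C$. -/

import Mathlib

open Set MeasureTheory TopologicalSpace Bundle
open scoped Manifold ContDiff Bundle ENNReal NNReal

noncomputable section

namespace CechForms

section Forms

variable {n : ℕ} {M : Type*} [TopologicalSpace M] [ChartedSpace (EuclideanSpace ℝ (Fin n)) M]

/-- Alternating `r`-linear forms on the tangent space `T_x M`. -/
abbrev AltForm (n r : ℕ) {M : Type*} [TopologicalSpace M]
    [ChartedSpace (EuclideanSpace ℝ (Fin n)) M] (x : M) : Type _ :=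
  TangentSpace (𝓡 n) x [⋀^Fin r]→L[ℝ] ℝ

open Classical in
/-- Extension by zero of a (not necessarily smooth) `r`-form on the open set `U` to all of `M`. -/
def extendZero {r : ℕ} {U : Opens M} (w : (x : U) → AltForm n r (x : M)) (x : M) :
    AltForm n r x :=
  if h : x ∈ U then w ⟨x, h⟩ else 0

/-- The expression of an `r`-form in the chart centred at `c`, that is, its pullback under the
inverse of this chart. -/
def chartRep {r : ℕ} (c : M) (w : (x : M) → AltForm n r x) (y : EuclideanSpace ℝ (Fin n)) :
    EuclideanSpace ℝ (Fin n) [⋀^Fin r]→L[ℝ] ℝ :=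
  (w ((chartAt (EuclideanSpace ℝ (Fin n)) c).symm y)).compContinuousLinearMap
    (mfderiv (𝓡 n) (𝓡 n) (chartAt (EuclideanSpace ℝ (Fin n)) c).symm y)

/-- The part of the target of the chart centred at `c` that corresponds to the open set `U`. -/
def chartDom (c : M) (U : Opens M) : Set (EuclideanSpace ℝ (Fin n)) :=
  (chartAt (EuclideanSpace ℝ (Fin n)) c).target ∩
    (chartAt (EuclideanSpace ℝ (Fin n)) c).symm ⁻¹' (U : Set M)

/-- An `r`-form on `U` is smooth if its expression in every chart is smooth. -/
def IsSmoothForm {r : ℕ} (U : Opens M) (w : (x : U) → AltForm n r (x : M)) : Prop :=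
  ∀ c : M, ContDiffOn ℝ ∞ (chartRep c (extendZero w)) (chartDom c U)

theorem chartRep_extendZero_zero {r : ℕ} (U : Opens M) (c : M) :
    chartRep c (extendZero (0 : (x : U) → AltForm n r (x : M))) = 0 := by
  funext y
  ext v
  simp only [chartRep, extendZero]
  split_ifs <;> rfl

theorem chartRep_extendZero_add {r : ℕ} {U : Opens M} (c : M)
    (w η : (x : U) → AltForm n r (x : M)) :
    chartRep c (extendZero (w + η)) =
      chartRep c (extendZero w) + chartRep c (extendZero η) := by
  funext y
  ext v
  simp only [chartRep, extendZero, Pi.add_apply]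
  split_ifs
  · rfl
  · exact (add_zero (0 : ℝ)).symm

theorem chartRep_extendZero_smul {r : ℕ} {U : Opens M} (c : M) (a : ℝ)
    (w : (x : U) → AltForm n r (x : M)) :
    chartRep c (extendZero (a • w)) = a • chartRep c (extendZero w) := by
  funext y
  ext v
  simp only [chartRep, extendZero, Pi.smul_apply]
  split_ifs
  · rfl
  · exact (mul_zero a).symm

/-- `Ω^r(U)`, the real vector space of smooth `r`-forms on the open set `U`. -/
def Form (n r : ℕ) {M : Type*} [TopologicalSpace M]
    [ChartedSpace (EuclideanSpace ℝ (Fin n)) M] (U : Opens M) :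
    Submodule ℝ ((x : U) → AltForm n r (x : M)) where
  carrier := {w | IsSmoothForm U w}
  zero_mem' := fun c => by
    rw [chartRep_extendZero_zero]
    exact contDiffOn_const
  add_mem' := fun {w η} hw hη c => by
    rw [chartRep_extendZero_add]
    exact (hw c).add (hη c)
  smul_mem' := fun a w hw c => by
    rw [chartRep_extendZero_smul]
    exact contDiffOn_const.smul (hw c)

/-- Restriction `Ω^r(U) → Ω^r(V)` for `V ⊆ U`. -/
def Form.restrict {r : ℕ} {U V : Opens M} (h : V ≤ U) : Form n r U →ₗ[ℝ] Form n r V where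
  toFun w := ⟨fun x => w.1 ⟨x.1, h x.2⟩, fun c => by
    refine ((w.2 c).mono (fun y hy => ⟨hy.1, h hy.2⟩)).congr (fun y hy => ?_)
    have h1 : (chartAt (EuclideanSpace ℝ (Fin n)) c).symm y ∈ V := hy.2
    simp only [chartRep, extendZero, h1, h h1, dif_pos]⟩
  map_add' _ _ := rfl
  map_smul' _ _ := rfl

/-- The exterior derivative of an `r`-form, at the point `x`: express the form in the chart centred
at `x`, take the exterior derivative in Euclidean space, and pull the result back. -/
def extDerivAt {r : ℕ} (w : (x : M) → AltForm n r x) (x : M) : AltForm n (r + 1) x :=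
  (extDeriv (chartRep x w) (chartAt (EuclideanSpace ℝ (Fin n)) x x)).compContinuousLinearMap
    (mfderiv (𝓡 n) (𝓡 n) (chartAt (EuclideanSpace ℝ (Fin n)) x) x)

theorem isOpen_chartDom (c : M) (U : Opens M) : IsOpen (chartDom (n := n) c U) :=
  (chartAt (EuclideanSpace ℝ (Fin n)) c).isOpen_inter_preimage_symm U.isOpen

/-- In any chart, the exterior derivative is the Euclidean exterior derivative. -/
theorem chartRep_extDerivAt [IsManifold (𝓡 n) ∞ M] {r : ℕ} (U : Opens M)
    (w : (x : M) → AltForm n r x)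
    (hw : ∀ c : M, ContDiffOn ℝ ∞ (chartRep c w) (chartDom c U)) (c : M)
    (y : EuclideanSpace ℝ (Fin n)) (hy : y ∈ chartDom c U) :
    chartRep c (extDerivAt w) y = extDeriv (chartRep c w) y := by
  set φ := chartAt (EuclideanSpace ℝ (Fin n)) c with hφ
  obtain ⟨hyt, hyU⟩ := hy
  set x : M := φ.symm y with hx
  set ψ := chartAt (EuclideanSpace ℝ (Fin n)) x with hψ
  have hxU : x ∈ U := hyU
  have hxψ : x ∈ ψ.source := mem_chart_source _ x
  -- derivatives of the charts
  have dφ : ∀ z ∈ φ.target, MDifferentiableAt (𝓡 n) (𝓡 n) φ.symm z := fun z hz =>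
    mdifferentiableAt_atlas_symm (chart_mem_atlas _ c) hz
  have dψ : ∀ z ∈ ψ.source, MDifferentiableAt (𝓡 n) (𝓡 n) ψ z := fun z hz =>
    mdifferentiableAt_atlas (chart_mem_atlas _ x) hz
  have dψs : ∀ z ∈ ψ.target, MDifferentiableAt (𝓡 n) (𝓡 n) ψ.symm z := fun z hz =>
    mdifferentiableAt_atlas_symm (chart_mem_atlas _ x) hz
  -- the transition map
  have hτ : ContDiffAt ℝ ∞ (ψ ∘ φ.symm) y := by
    have h1 : ContMDiffAt (𝓡 n) (𝓡 n) ∞ φ.symm y :=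
      (contMDiffOn_chart_symm (I := 𝓡 n) (n := ∞) (x := c)).contMDiffAt
        (φ.open_target.mem_nhds hyt)
    have h2 : ContMDiffAt (𝓡 n) (𝓡 n) ∞ ψ (φ.symm y) :=
      (contMDiffOn_chart (I := 𝓡 n) (n := ∞) (x := x)).contMDiffAt
        (ψ.open_source.mem_nhds hxψ)
    exact (h2.comp y h1).contDiffAt
  have hyO : y ∈ chartDom c (⟨ψ.source, ψ.open_source⟩ : Opens M) := ⟨hyt, hxψ⟩
  have hO : chartDom c (⟨ψ.source, ψ.open_source⟩ : Opens M) ∈ nhds y :=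
    (isOpen_chartDom c _).mem_nhds hyO
  have key : ∀ z ∈ chartDom c (⟨ψ.source, ψ.open_source⟩ : Opens M),
      chartRep c w z =
        (chartRep x w ((ψ ∘ φ.symm) z)).compContinuousLinearMap (fderiv ℝ (ψ ∘ φ.symm) z) := by
    rintro z ⟨hz1, hz2⟩
    have hz2' : φ.symm z ∈ ψ.source := hz2
    have hl : ψ.symm (ψ (φ.symm z)) = φ.symm z := ψ.left_inv hz2'
    have hcomp : MDifferentiableAt (𝓡 n) (𝓡 n) (ψ ∘ φ.symm) z :=
      (dψ _ hz2').comp z (dφ z hz1)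
    have hd : mfderiv (𝓡 n) (𝓡 n) (ψ.symm ∘ (ψ ∘ φ.symm)) z =
        (mfderiv (𝓡 n) (𝓡 n) ψ.symm ((ψ ∘ φ.symm) z)).comp
          (mfderiv (𝓡 n) (𝓡 n) (ψ ∘ φ.symm) z) :=
      mfderiv_comp z (dψs _ (ψ.map_source hz2')) hcomp
    have hev : (ψ.symm ∘ (ψ ∘ φ.symm)) =ᶠ[nhds z] φ.symm :=
      Filter.eventually_of_mem ((isOpen_chartDom c _).mem_nhds
        (show z ∈ chartDom c (⟨ψ.source, ψ.open_source⟩ : Opens M) from ⟨hz1, hz2⟩))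
        (fun q hq => ψ.left_inv hq.2)
    have hd2 : mfderiv (𝓡 n) (𝓡 n) (ψ.symm ∘ (ψ ∘ φ.symm)) z =
        mfderiv (𝓡 n) (𝓡 n) φ.symm z := hev.mfderiv_eq
    have hgen : ∀ (p q : M) (_ : p = q)
        (A B : EuclideanSpace ℝ (Fin n) →L[ℝ] EuclideanSpace ℝ (Fin n)) (_ : A = B),
        ContinuousAlternatingMap.compContinuousLinearMap
          (w p : EuclideanSpace ℝ (Fin n) [⋀^Fin r]→L[ℝ] ℝ) A =
        ContinuousAlternatingMap.compContinuousLinearMap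
          (w q : EuclideanSpace ℝ (Fin n) [⋀^Fin r]→L[ℝ] ℝ) B := by
      rintro p q rfl A B rfl; rfl
    have hm : mfderiv (𝓡 n) (𝓡 n) (ψ ∘ φ.symm) z = fderiv ℝ (ψ ∘ φ.symm) z :=
      mfderiv_eq_fderiv
    refine (hgen _ _ hl.symm _ _ (hd2.symm.trans hd)).trans ?_
    rw [hm]
    rfl
  have hrep : DifferentiableAt ℝ (chartRep x w) ((ψ ∘ φ.symm) y) := by
    refine ((hw x).differentiableOn (by simp)).differentiableAt
      ((isOpen_chartDom x U).mem_nhds ⟨ψ.map_source hxψ, ?_⟩)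
    change ψ.symm (ψ x) ∈ U
    rw [ψ.left_inv hxψ]
    exact hxU
  have hpull := extDeriv_pullback hrep hτ
    (by rw [minSmoothness_of_isRCLikeNormedField]; exact WithTop.coe_le_coe.2 le_top)
  have e1 : extDeriv (chartRep c w) y = (extDeriv (chartRep x w)
      ((ψ ∘ φ.symm) y)).compContinuousLinearMap (fderiv ℝ (ψ ∘ φ.symm) y) := by
    rw [← hpull]
    exact Filter.EventuallyEq.extDeriv_eq (Filter.eventually_of_mem hO key)
  rw [e1]
  have hm : fderiv ℝ (ψ ∘ φ.symm) y = (mfderiv (𝓡 n) (𝓡 n) ψ x).comp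
      (mfderiv (𝓡 n) (𝓡 n) φ.symm y) :=
    (mfderiv_eq_fderiv (f := ψ ∘ φ.symm) (x := y)).symm.trans
      (mfderiv_comp y (dψ x hxψ) (dφ y hyt))
  rw [hm]
  rfl

/-- The exterior derivative `d : Ω^r(U) → Ω^{r+1}(U)`. -/
def Form.d [IsManifold (𝓡 n) ∞ M] {r : ℕ} {U : Opens M} (w : Form n r U) :
    Form n (r + 1) U :=
  ⟨fun x => extDerivAt (extendZero w.1) x, fun c => by
    have h1 : ContDiffOn ℝ ∞ (extDeriv (chartRep c (extendZero w.1))) (chartDom c U) := by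
      have h2 := (w.2 c).fderiv_of_isOpen (m := ∞) (isOpen_chartDom c U) (by simp)
      exact (ContinuousLinearMap.contDiff
        (ContinuousAlternatingMap.alternatizeUncurryFinCLM (n := r) ℝ
          (EuclideanSpace ℝ (Fin n)) ℝ)).comp_contDiffOn h2
    refine h1.congr (fun y hy => ?_)
    rw [← chartRep_extDerivAt U (extendZero w.1) w.2 c y hy]
    have hx : (chartAt (EuclideanSpace ℝ (Fin n)) c).symm y ∈ U := hy.2
    simp only [chartRep, extendZero, hx, dif_pos]⟩

end Forms

section Norms

/-- The Euclidean norm on alternating `r`-forms on an inner product space `V`: for an orthonormal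
basis `e`, its square is the sum of `w (e i₁, …, e iᵣ) ^ 2` over `i₁ < ⋯ < iᵣ`, written here as
`1 / r!` times the sum over all tuples of indices. -/
def altNorm {V : Type*} [NormedAddCommGroup V] [InnerProductSpace ℝ V] [FiniteDimensional ℝ V]
    {r : ℕ} (w : V [⋀^Fin r]→L[ℝ] ℝ) : ℝ :=
  Real.sqrt ((r.factorial : ℝ)⁻¹ * ∑ J : Fin r → Fin (Module.finrank ℝ V),
    (w fun k => stdOrthonormalBasis ℝ V (J k)) ^ 2)

variable {n : ℕ} (M : Type*) [TopologicalSpace M] [ChartedSpace (EuclideanSpace ℝ (Fin n)) M]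
  [RiemannianBundle (fun x : M => TangentSpace (𝓡 n) x)]

variable {M} in
/-- The Gram matrix `g_ij` of the Riemannian metric in the chart centred at `c`. -/
def gramMatrix (c : M) (y : EuclideanSpace ℝ (Fin n)) : Matrix (Fin n) (Fin n) ℝ :=
  Matrix.of fun i j =>
    inner ℝ
      (mfderiv (𝓡 n) (𝓡 n) (chartAt (EuclideanSpace ℝ (Fin n)) c).symm y
        (EuclideanSpace.single i (1 : ℝ)) :
        TangentSpace (𝓡 n) ((chartAt (EuclideanSpace ℝ (Fin n)) c).symm y))
      (mfderiv (𝓡 n) (𝓡 n) (chartAt (EuclideanSpace ℝ (Fin n)) c).symm y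
        (EuclideanSpace.single j (1 : ℝ)))

variable {M} in
/-- The Riemannian measure of the domain of the chart centred at `c`: in the chart it is
`√(det g) dy`. It is extended by zero to `M`. -/
def chartVolume [MeasurableSpace M] (c : M) : Measure M :=
  Measure.map (chartAt (EuclideanSpace ℝ (Fin n)) c).symm
    ((volume.restrict (chartAt (EuclideanSpace ℝ (Fin n)) c).target).withDensity
      fun y => ENNReal.ofReal (Real.sqrt (gramMatrix c y).det))

/-- The Riemannian volume measure. The measures of the chart domains agree on overlaps, so their
least upper bound is the measure that restricts to each of them. -/
def riemannianVolume (n : ℕ) (M : Type*) [TopologicalSpace M]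
    [ChartedSpace (EuclideanSpace ℝ (Fin n)) M]
    [RiemannianBundle (fun x : M => TangentSpace (𝓡 n) x)] [MeasurableSpace M] : Measure M :=
  ⨆ c : M, chartVolume (n := n) c

variable {M} in
/-- The pointwise norm of an alternating form on `T_x M` induced by the Riemannian metric. -/
def pointNorm {r : ℕ} (x : M) (w : AltForm n r x) : ℝ :=
  haveI : FiniteDimensional ℝ (TangentSpace (𝓡 n) x) :=
    inferInstanceAs (FiniteDimensional ℝ (EuclideanSpace ℝ (Fin n)))
  altNorm w

variable {M} in
/-- `‖w‖_{L^p(U)} = (∫_U |w|^p dVol)^{1/p}`, possibly infinite. -/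
def Form.lpNorm [MeasurableSpace M] {r : ℕ} {U : Opens M} (p : ℝ) (w : Form n r U) : ℝ≥0∞ :=
  (∫⁻ x in (U : Set M), ENNReal.ofReal (pointNorm x (extendZero w.1 x)) ^ p
    ∂(riemannianVolume n M)) ^ (1 / p)

end Norms

section Cech

variable {n N : ℕ} {M : Type*} [TopologicalSpace M] [ChartedSpace (EuclideanSpace ℝ (Fin n)) M]
  (U : Fin N → Opens M)

/-- `U_J = U_{j_0} ∩ ⋯ ∩ U_{j_{s-1}}`, which is `M` when `s = 0`. -/
def inter {s : ℕ} (J : Fin s → Fin N) : Opens M :=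
  ⟨⋂ k, (U (J k) : Set M), isOpen_iInter_of_finite fun k => (U (J k)).isOpen⟩

theorem inter_le_comp {s t : ℕ} (J : Fin s → Fin N) (f : Fin t → Fin s) :
    inter U J ≤ inter U (J ∘ f) :=
  fun _ hx => mem_iInter.2 fun k => mem_iInter.1 hx (f k)

/-- `K^{r,s}`: families of smooth `r`-forms on `U_I`, where `I` runs over the increasing
`s`-tuples of indices. For `s = 0` there is one such tuple, the empty one, and `U_I = M`. -/
abbrev K (n r s : ℕ) {N : ℕ} {M : Type*} [TopologicalSpace M]
    [ChartedSpace (EuclideanSpace ℝ (Fin n)) M] (U : Fin N → Opens M) : Type _ :=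
  (I : Fin s ↪o Fin N) → Form n r (inter U I)

/-- The Čech differential: `(δ α)_J` is the alternating sum of the restrictions to `U_J` of the
components of `α` whose index is `J` with one entry omitted. -/
def delta (r s : ℕ) : K n r s U →ₗ[ℝ] K n r (s + 1) U :=
  LinearMap.pi fun J => ∑ t : Fin (s + 1), (-1 : ℝ) ^ (t : ℕ) •
    (Form.restrict (inter_le_comp U J (Fin.succAboveOrderEmb t))).comp
      (LinearMap.proj ((Fin.succAboveOrderEmb t).trans J))

/-- The exterior derivative `d : K^{r,s} → K^{r+1,s}`, taken in each component. -/
def K.d [IsManifold (𝓡 n) ∞ M] {U : Fin N → Opens M} {r s : ℕ} (α : K n r s U) :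
    K n (r + 1) s U :=
  fun I => Form.d (α I)

/-- `‖α‖_{L^p(K^{r,s})}`, the sum of the `L^p` norms of the components. -/
def K.lpNorm [RiemannianBundle (fun x : M => TangentSpace (𝓡 n) x)] [MeasurableSpace M]
    {U : Fin N → Opens M} {r s : ℕ} (p : ℝ) (α : K n r s U) : ℝ≥0∞ :=
  ∑ I : Fin s ↪o Fin N, Form.lpNorm p (α I)

/-- The component `α_J` for an arbitrary tuple `J` of indices, by antisymmetry: it is zero if `J`
has a repeated entry, and otherwise it is the component of the sorted tuple times the sign of the
sorting permutation. -/
def K.component {U : Fin N → Opens M} {r s : ℕ} (α : K n r s U) (J : Fin s → Fin N) :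
    Form n r (inter U J) :=
  open Classical in
  if h : Function.Injective J then
    ((Equiv.Perm.sign (Tuple.sort J) : ℤ) : ℝ) •
      Form.restrict (inter_le_comp U J (Tuple.sort J))
        (α (OrderEmbedding.ofStrictMono (J ∘ Tuple.sort J)
          ((Tuple.monotone_sort J).strictMono_of_injective
            (h.comp (Tuple.sort J).injective))))
  else 0

end Cech

end CechForms

end

/-! A partition of unity gives a contracting homotopy of the Čech complex: put (hβ)_I = ∑ ρ_j
β_{jI}. At a point x of U_j ∩ U_J the cocycle identity for the tuple (j, J) reads ∑ (-1)^t β_{j,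
J∖J_t} = β_J. Multiplying by ρ_j, summing over j and using ∑ ρ_j = 1 gives δhβ = β
(`delta_homotopy`). The cocycle condition is given only on increasing tuples, so its extension to
(j, J) is a matter of signs, settled for antisymmetric functions in `IsAntisymm.cechSum_cons`. The
identities for δ are checked in a single fibre, on the values `K.value` of the components extended
by zero. Each summand of hβ is smooth on U_I because ρ_j vanishes near every point of U_I outside
U_j.

The estimates hold for every β, cocycle or not. Pointwise, |hβ| is at most the sum of the |β_{jI}|,
as 0 ≤ ρ_j ≤ 1. By Leibniz, d(hβ) is controlled by the β_{jI} and dβ_{jI}, with a constant involving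
dρ_j. That bound is obtained near each point in a chart, where the Riemannian and Euclidean norms
are comparable, and is made uniform by compactness (`exists_pointNorm_d_homotopy_le`). Minkowski's
inequality then passes to L^p. Its measurability requirement is met by replacing pointwise norms
with comparable measurable functions, at the price of a constant. -/

noncomputable section

namespace CechForms

/-! ### Signs and antisymmetric functions of tuples -/

section Combinatorics

variable {E ι : Type*} [AddCommGroup E] [Module ℝ E]

/-- The value of the Čech differential on an arbitrary tuple of indices. -/
def cechSum {s : ℕ} (b : (Fin s → ι) → E) (L : Fin (s + 1) → ι) : E :=
  ∑ t : Fin (s + 1), (-1 : ℝ) ^ (t : ℕ) • b (L ∘ t.succAbove)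

/-- Deleting two entries in either order leaves the same tuple, with opposite signs. The map
exchanging the two orders is a fixed-point-free involution on the terms of the double sum.
Antisymmetry of `b` plays no role. -/
theorem cechSum_cechSum {s : ℕ} (b : (Fin s → ι) → E) (L : Fin (s + 2) → ι) :
    cechSum (cechSum b) L = 0 := by
  simp only [cechSum, Finset.smul_sum, smul_smul, ← pow_add]
  rw [← Finset.sum_product']
  refine Finset.sum_involution (fun q _ => (q.1.succAbove q.2, q.2.predAbove q.1)) ?_ ?_ ?_ ?_
  · rintro ⟨i, j⟩ -
    have h : (L ∘ (i.succAbove j).succAbove) ∘ (j.predAbove i).succAbove =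
        (L ∘ i.succAbove) ∘ j.succAbove := by
      funext k
      simp only [Function.comp_apply, Fin.succAbove_succAbove_succAbove_predAbove]
    simp only [h, Fin.neg_one_pow_succAbove_add_predAbove, neg_smul, add_neg_cancel]
  · rintro ⟨i, j⟩ - - h
    exact Fin.succAbove_ne i j (congrArg Prod.fst h)
  · rintro ⟨i, j⟩ -
    simp
  · rintro ⟨i, j⟩ -
    simp only [Prod.mk.injEq]
    exact ⟨Fin.succAbove_succAbove_predAbove i j, Fin.predAbove_predAbove_succAbove i j⟩

/-- A function of tuples of indices is antisymmetric if it changes by the sign under permutations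
of the tuple and vanishes on tuples with a repeated entry. -/
structure IsAntisymm {s : ℕ} (b : (Fin s → ι) → E) : Prop where
  perm : ∀ (J : Fin s → ι) (σ : Equiv.Perm (Fin s)),
    b (J ∘ σ) = ((Equiv.Perm.sign σ : ℤ) : ℝ) • b J
  zero : ∀ J : Fin s → ι, ¬ Function.Injective J → b J = 0

/-- Moving the entry from position `k` to the front is a cycle of length k + 1, of sign (-1)^k. -/
theorem IsAntisymm.insertNth {s : ℕ} {b : (Fin (s + 1) → ι) → E} (hb : IsAntisymm b)
    (k : Fin (s + 1)) (j : ι) (J : Fin s → ι) :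
    b (k.insertNth j J) = (-1 : ℝ) ^ (k : ℕ) • b (Fin.cons j J) := by
  rw [← Fin.cons_comp_cycleRange, hb.perm, Fin.sign_cycleRange]
  simp

theorem insertNth_comp_succAbove_succAbove {s : ℕ} (k : Fin (s + 2)) (u : Fin (s + 1)) (j : ι)
    (J : Fin (s + 1) → ι) :
    (k.insertNth j J : Fin (s + 2) → ι) ∘ (k.succAbove u).succAbove =
      ((u.predAbove k).insertNth j (J ∘ u.succAbove) : Fin (s + 1) → ι) := by
  refine (Fin.insertNth_eq_iff.2 ⟨?_, ?_⟩).symm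
  · simp [Fin.succAbove_succAbove_predAbove]
  · funext v
    simp [Fin.removeNth, Fin.succAbove_succAbove_succAbove_predAbove]

/-- Sort (j, J) and let `k` be the place where j lands. What remains after deleting j is increasing
with the same range as J, and an increasing tuple is determined by its range. -/
theorem exists_strictMono_insertNth [LinearOrder ι] {s : ℕ} {J : Fin s → ι} (hJ : StrictMono J)
    {j : ι} (hj : j ∉ range J) :
    ∃ k : Fin (s + 1), StrictMono (k.insertNth j J : Fin (s + 1) → ι) := by
  have hinj : Function.Injective (Fin.cons j J : Fin (s + 1) → ι) :=
    Fin.cons_injective_iff.2 ⟨hj, hJ.injective⟩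
  set σ := Tuple.sort (Fin.cons j J : Fin (s + 1) → ι) with hσ
  set L := (Fin.cons j J : Fin (s + 1) → ι) ∘ σ with hL
  have hLm : StrictMono L :=
    (Tuple.monotone_sort _).strictMono_of_injective (hinj.comp σ.injective)
  set k := σ.symm 0 with hk
  have hLk : L k = j := by simp [hL, hk]
  have hrange : range (k.removeNth L) = range J := by
    have h1 : range L = insert j (range J) := by
      rw [hL, σ.surjective.range_comp, Fin.range_cons]
    have h2 : range L = insert j (range (k.removeNth L)) := by
      conv_lhs => rw [← Fin.insertNth_self_removeNth k L, hLk]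
      exact Fin.range_insertNth _ _ _
    have h3 : j ∉ range (k.removeNth L) := by
      rintro ⟨u, hu⟩
      exact Fin.succAbove_ne k u (hLm.injective (hu.trans hLk.symm))
    rw [← insert_sdiff_self_of_notMem h3, ← h2, h1, insert_sdiff_self_of_notMem hj]
  have hrem : k.removeNth L = J :=
    (StrictMono.range_inj (hLm.comp (Fin.strictMono_succAbove k)) hJ).1 hrange
  refine ⟨k, ?_⟩
  rwa [← hrem, ← hLk, Fin.insertNth_self_removeNth]

/-- An antisymmetric cocycle satisfies the cocycle identity for the tuple `(j, J)`. -/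
theorem IsAntisymm.cechSum_cons [LinearOrder ι] {s : ℕ} {b : (Fin (s + 1) → ι) → E}
    (hb : IsAntisymm b) {S : Set ι}
    (hcoc : ∀ L : Fin (s + 2) → ι, StrictMono L → (∀ k, L k ∈ S) → cechSum b L = 0)
    {J : Fin (s + 1) → ι} (hJ : StrictMono J) (hJS : ∀ k, J k ∈ S) {j : ι} (hj : j ∈ S) :
    ∑ t : Fin (s + 1), (-1 : ℝ) ^ (t : ℕ) • b (Fin.cons j (J ∘ t.succAbove)) = b J := by
  by_cases hjJ : j ∈ range J
  -- If j = J t₀, every term with t ≠ t₀ has a repeated index, and the term t₀ is J with one entry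
  -- moved to the front.
  · obtain ⟨t₀, rfl⟩ := hjJ
    rw [Finset.sum_eq_single t₀]
    · rw [← hb.insertNth]
      exact congrArg b (Fin.insertNth_self_removeNth t₀ J)
    · intro t _ ht
      rw [hb.zero, smul_zero]
      intro hinj
      obtain ⟨u, hu⟩ := Fin.exists_succAbove_eq ht.symm
      have : (Fin.cons (J t₀) (J ∘ t.succAbove) : Fin (s + 1) → ι) u.succ =
          (Fin.cons (J t₀) (J ∘ t.succAbove) : Fin (s + 1) → ι) 0 := by
        simp [hu]
      exact Fin.succ_ne_zero u (hinj this)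
    · simp
  · obtain ⟨k, hk⟩ := exists_strictMono_insertNth hJ hjJ
    have h := hcoc _ hk (fun i => by
      rcases Fin.eq_self_or_eq_succAbove k i with rfl | ⟨u, rfl⟩
      · simpa using hj
      · simpa using hJS u)
    -- The term deleting position k is (-1)^k b(J). In the others, moving j to the front leaves
    -- (-1)^k times the wanted sign, with a minus, so (-1)^k cancels throughout.
    rw [cechSum, Fin.sum_univ_succAbove _ k] at h
    have h1 : (k.insertNth j J : Fin (s + 2) → ι) ∘ k.succAbove = J := by
      funext u; simp
    simp only [insertNth_comp_succAbove_succAbove, hb.insertNth, smul_smul, ← pow_add,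
      Fin.neg_one_pow_succAbove_add_predAbove, neg_smul, Finset.sum_neg_distrib, h1] at h
    rw [add_neg_eq_zero] at h
    simp only [pow_add, mul_smul, ← Finset.smul_sum] at h
    exact (smul_right_injective E (pow_ne_zero (k : ℕ) (by norm_num : (-1 : ℝ) ≠ 0)) h).symm

end Combinatorics

/-! ### The Čech complex in a single fibre -/

section Pointwise

variable {n N : ℕ} {M : Type*} [TopologicalSpace M] [ChartedSpace (EuclideanSpace ℝ (Fin n)) M]

theorem extendZero_of_mem {r : ℕ} {U : Opens M} (w : (x : U) → AltForm n r (x : M)) {x : M}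
    (hx : x ∈ U) : extendZero w x = w ⟨x, hx⟩ :=
  dif_pos hx

theorem extendZero_of_notMem {r : ℕ} {U : Opens M} (w : (x : U) → AltForm n r (x : M)) {x : M}
    (hx : x ∉ U) : extendZero w x = 0 :=
  dif_neg hx

theorem extendZero_zero {r : ℕ} (U : Opens M) (x : M) :
    extendZero (0 : (x : U) → AltForm n r (x : M)) x = 0 := by
  unfold extendZero; split_ifs <;> rfl

theorem extendZero_smul {r : ℕ} {U : Opens M} (a : ℝ) (w : (x : U) → AltForm n r (x : M)) (x : M) :
    extendZero (a • w) x = a • extendZero w x := by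
  unfold extendZero; split_ifs
  · rfl
  · exact (smul_zero a).symm

theorem extendZero_restrict {r : ℕ} {U V : Opens M} (h : V ≤ U) (w : Form n r U) {x : M}
    (hx : x ∈ V) : extendZero (Form.restrict h w).1 x = extendZero w.1 x := by
  rw [extendZero_of_mem _ hx, extendZero_of_mem _ (h hx)]; rfl

theorem mem_inter {U : Fin N → Opens M} {s : ℕ} {J : Fin s → Fin N} {x : M} :
    x ∈ inter U J ↔ ∀ k, x ∈ U (J k) :=
  mem_iInter

/-- The value at `x` of the component of `α` at an arbitrary tuple of indices, extended by zero. -/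
def K.value {U : Fin N → Opens M} {r s : ℕ} (α : K n r s U) (x : M) (J : Fin s → Fin N) :
    AltForm n r x :=
  extendZero (α.component J).1 x

variable {U : Fin N → Opens M} {r s : ℕ}

theorem mem_inter_cons {j : Fin N} {I : Fin s → Fin N} {x : M} (hj : x ∈ U j)
    (hI : x ∈ inter U I) : x ∈ inter U (Fin.cons j I : Fin (s + 1) → Fin N) :=
  mem_inter.2 (Fin.cases hj (mem_inter.1 hI))

/-- Since J is injective, `σ` is the only permutation sorting it, so the sign and component in
`K.component` may be computed from any sorting data at hand. -/
theorem K.value_of_comp (α : K n r s U) (x : M) (J : Fin s → Fin N) (I : Fin s ↪o Fin N)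
    (σ : Equiv.Perm (Fin s)) (h : J ∘ σ = I) :
    α.value x J = ((Equiv.Perm.sign σ : ℤ) : ℝ) • extendZero (α I).1 x := by
  have hJ : Function.Injective J := by
    have : J = I ∘ σ.symm := by rw [← h]; funext k; simp
    rw [this]
    exact I.injective.comp σ.symm.injective
  have hσ : Tuple.sort J = σ := by
    have h1 : J ∘ σ = J ∘ Tuple.sort J := by
      rw [Tuple.comp_sort_eq_comp_iff_monotone, h]
      exact I.monotone
    exact (Equiv.ext fun k => hJ (congrFun h1 k)).symm
  subst hσ
  have hI : OrderEmbedding.ofStrictMono (J ∘ Tuple.sort J)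
      ((Tuple.monotone_sort J).strictMono_of_injective (hJ.comp (Tuple.sort J).injective)) = I := by
    ext k
    rw [← h]; rfl
  rw [K.value, K.component, dif_pos hJ]
  simp only [Submodule.coe_smul]
  rw [extendZero_smul]
  congr 1
  -- U_J and U_I are the same set, so outside it both extensions by zero vanish.
  by_cases hx : x ∈ inter U J
  · refine (extendZero_restrict (inter_le_comp U J (Tuple.sort J)) _ hx).trans ?_
    exact congrArg (fun I' : Fin s ↪o Fin N => extendZero (α I').1 x) hI
  · rw [extendZero_of_notMem _ hx, extendZero_of_notMem]
    intro hx'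
    refine hx (mem_inter.2 fun k => ?_)
    have := mem_inter.1 hx' ((Tuple.sort J).symm k)
    rw [← h] at this
    simpa using this

theorem K.value_coe (α : K n r s U) (x : M) (I : Fin s ↪o Fin N) :
    α.value x I = extendZero (α I).1 x := by
  rw [α.value_of_comp x I I 1 rfl]; simp

theorem K.value_zero (α : K n r s U) (x : M) {J : Fin s → Fin N} (hJ : ¬ Function.Injective J) :
    α.value x J = 0 := by
  rw [K.value, K.component, dif_neg hJ]
  exact extendZero_zero _ x

/-- Every injective tuple is a permutation of an increasing one. -/
theorem exists_perm_comp_eq {J : Fin s → Fin N} (hJ : Function.Injective J) :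
    ∃ (σ : Equiv.Perm (Fin s)) (I : Fin s ↪o Fin N), J ∘ σ = I :=
  ⟨Tuple.sort J, OrderEmbedding.ofStrictMono _ ((Tuple.monotone_sort J).strictMono_of_injective
    (hJ.comp (Tuple.sort J).injective)), rfl⟩

theorem K.isAntisymm_value (α : K n r s U) (x : M) : IsAntisymm (α.value x) where
  perm J σ := by
    by_cases hJ : Function.Injective J
    · obtain ⟨τ, I, h⟩ := exists_perm_comp_eq hJ
      rw [α.value_of_comp x J I τ h, α.value_of_comp x (J ∘ σ) I (σ⁻¹ * τ)
        (by rw [← h]; funext k; simp), smul_smul]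
      simp
    · rw [α.value_zero x hJ, α.value_zero x, smul_zero]
      intro h
      refine hJ ?_
      have : J = (J ∘ σ) ∘ σ.symm := by funext k; simp
      rw [this]
      exact h.comp σ.symm.injective
  zero J hJ := α.value_zero x hJ

theorem coe_sum_apply {ι : Type*} (t : Finset ι) {V : Opens M} (w : ι → Form n r V) (x : V) :
    (∑ i ∈ t, w i : Form n r V).1 x = ∑ i ∈ t, (w i).1 x := by
  have h : (∑ i ∈ t, w i : Form n r V).1 = ∑ i ∈ t, (w i).1 := Submodule.coe_sum _ _ _
  rw [h, Finset.sum_apply]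

/-- This reduces statements about δ to the combinatorics of `cechSum` in the fixed vector space of
forms at `x`. -/
theorem delta_apply (α : K n r s U) (J : Fin (s + 1) ↪o Fin N) (x : inter U J) :
    (delta U r s α J).1 x = cechSum (α.value (x : M)) J := by
  have h : delta U r s α J = ∑ t : Fin (s + 1), (-1 : ℝ) ^ (t : ℕ) •
      Form.restrict (inter_le_comp U J (Fin.succAboveOrderEmb t))
        (α ((Fin.succAboveOrderEmb t).trans J)) := by
    rw [delta, LinearMap.pi_apply, LinearMap.sum_apply]
    rfl
  rw [h, coe_sum_apply]
  refine Finset.sum_congr rfl fun t _ => ?_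
  have h2 : (⇑J ∘ t.succAbove) = ((Fin.succAboveOrderEmb t).trans J : Fin s ↪o Fin N) := rfl
  rw [h2, K.value_coe]
  exact congrArg (fun z => (-1 : ℝ) ^ (t : ℕ) • z) (extendZero_of_mem
    (α ((Fin.succAboveOrderEmb t).trans J)).1 (inter_le_comp U J (Fin.succAboveOrderEmb t) x.2)).symm

theorem extendZero_delta (α : K n r s U) (J : Fin (s + 1) ↪o Fin N) {x : M} (hx : x ∈ inter U J) :
    extendZero (delta U r s α J).1 x = cechSum (α.value x) J := by
  rw [extendZero_of_mem _ hx, delta_apply]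

theorem K.ext_apply {α β : K n r s U} (h : ∀ (I : Fin s ↪o Fin N) (x : inter U I), (α I).1 x = (β I).1 x) : α = β :=
  funext fun I => Subtype.ext (funext (h I))

theorem value_delta (α : K n r s U) (J : Fin (s + 1) ↪o Fin N) {x : M} (hx : x ∈ inter U J) :
    (delta U r s α).value x J = cechSum (α.value x) J := by
  rw [K.value_coe, extendZero_delta _ _ hx]

theorem delta_comp_delta (U : Fin N → Opens M) (r s : ℕ) :
    (delta (n := n) U r (s + 1)).comp (delta U r s) = 0 := by
  refine LinearMap.ext fun α => K.ext_apply fun I x => ?_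
  rw [LinearMap.comp_apply, delta_apply]
  refine Eq.trans ?_ (cechSum_cechSum (α.value (x : M)) I)
  refine Finset.sum_congr rfl fun t _ => ?_
  congr 1
  exact value_delta α ((Fin.succAboveOrderEmb t).trans I) (inter_le_comp U I t.succAbove x.2)

/-- A form on M is determined by its restrictions to the members of the cover. -/
theorem delta_injective (hU : ⋃ i, (U i : Set M) = univ) :
    Function.Injective (delta (n := n) U r 0) := by
  rw [injective_iff_map_eq_zero]
  intro α hα
  refine K.ext_apply fun I x => ?_
  obtain ⟨i, hi⟩ := mem_iUnion.1 (hU ▸ mem_univ (x : M) : (x : M) ∈ ⋃ i, (U i : Set M))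
  let J : Fin 1 ↪o Fin N := OrderEmbedding.ofStrictMono (fun _ => i) (Subsingleton.strictMono _)
  have hx : (x : M) ∈ inter U J := mem_inter.2 fun _ => hi
  have h := delta_apply α J ⟨x, hx⟩
  rw [hα] at h
  have h2 : (⇑J ∘ (0 : Fin 1).succAbove) = I := Subsingleton.elim _ _
  have h3 : cechSum (α.value (x : M)) J = α.value (x : M) I := by
    refine Eq.trans ?_ (congrArg (α.value (x : M)) h2)
    exact (Fin.sum_univ_one _).trans (one_smul ℝ _)
  rw [h3, K.value_coe, extendZero_of_mem _ x.2] at h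
  exact h.symm

/-- If `β` is a cocycle, then `∑ (-1)^t β_{j, J \ J_t} = β_J` on `U_j ∩ U_J`. -/
theorem sum_value_cons_of_delta_eq_zero {β : K n r (s + 1) U} (hβ : delta U r (s + 1) β = 0)
    (J : Fin (s + 1) ↪o Fin N) {x : M} (hx : x ∈ inter U J) {j : Fin N} (hj : x ∈ U j) :
    ∑ t : Fin (s + 1), (-1 : ℝ) ^ (t : ℕ) • β.value x (Fin.cons j (J ∘ t.succAbove)) =
      β.value x J := by
  -- `S` is the set of indices i with x ∈ U_i: the cocycle condition at x is available exactly for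
  -- increasing tuples in `S`.
  refine (β.isAntisymm_value x).cechSum_cons (S := {i | x ∈ U i}) (fun L hL hLS => ?_)
    J.strictMono (mem_inter.1 hx) hj
  have h := delta_apply β (OrderEmbedding.ofStrictMono L hL) ⟨x, mem_inter.2 hLS⟩
  rw [hβ] at h
  exact h.symm

end Pointwise

/-! ### Products of forms with cutoff functions -/

section Cutoff

variable {n : ℕ} {M : Type*} [TopologicalSpace M] [ChartedSpace (EuclideanSpace ℝ (Fin n)) M]

theorem extDeriv_fun_sum {F : Type*} [NormedAddCommGroup F] [NormedSpace ℝ F] {ι : Type*} {r : ℕ}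
    (t : Finset ι) {η : ι → F → F [⋀^Fin r]→L[ℝ] ℝ} {y : F}
    (hη : ∀ i ∈ t, DifferentiableAt ℝ (η i) y) :
    extDeriv (fun z => ∑ i ∈ t, η i z) y = ∑ i ∈ t, extDeriv (η i) y := by
  simp only [extDeriv]
  rw [fderiv_fun_sum hη]
  exact map_sum (ContinuousAlternatingMap.alternatizeUncurryFinCLM (n := r) ℝ F ℝ) _ t

/-- Leibniz rule d(fη) = f dη + df ∧ η. The factor r + 1 bounds the alternatization, a sum of r + 1
terms. -/
theorem norm_extDeriv_fun_smul_le {F : Type*} [NormedAddCommGroup F] [NormedSpace ℝ F] {r : ℕ}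
    {f : F → ℝ} {η : F → F [⋀^Fin r]→L[ℝ] ℝ} {y : F} (hf : DifferentiableAt ℝ f y)
    (hη : DifferentiableAt ℝ η y) :
    ‖extDeriv (fun z => f z • η z) y‖ ≤
      |f y| * ‖extDeriv η y‖ + (r + 1) * (‖fderiv ℝ f y‖ * ‖η y‖) := by
  have h : extDeriv (fun z => f z • η z) y = f y • extDeriv η y +
      ContinuousAlternatingMap.alternatizeUncurryFin ((fderiv ℝ f y).smulRight (η y)) := by
    simp only [extDeriv]
    rw [fderiv_fun_smul hf hη]
    exact ((ContinuousAlternatingMap.alternatizeUncurryFinCLM (n := r) ℝ F ℝ).map_add _ _).trans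
      (congrArg (· + _)
        ((ContinuousAlternatingMap.alternatizeUncurryFinCLM (n := r) ℝ F ℝ).map_smul _ _))
  rw [h]
  refine (norm_add_le _ _).trans (add_le_add ?_ ?_)
  · rw [norm_smul, Real.norm_eq_abs]
  · refine (ContinuousAlternatingMap.norm_alternatizeUncurryFin_le _).trans ?_
    rw [ContinuousLinearMap.norm_smulRight_apply]

theorem chartRep_sum_smul {r : ℕ} {ι : Type*} (t : Finset ι) (c : M) (a : ι → M → ℝ)
    (w : ι → (x : M) → AltForm n r x) (y : EuclideanSpace ℝ (Fin n)) :
    chartRep c (fun x => ∑ j ∈ t, a j x • w j x) y =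
      ∑ j ∈ t, a j ((chartAt (EuclideanSpace ℝ (Fin n)) c).symm y) • chartRep c (w j) y := by
  ext v
  simp only [chartRep, ContinuousAlternatingMap.sum_apply, ContinuousAlternatingMap.smul_apply]
  exact (ContinuousAlternatingMap.sum_apply _ _).trans rfl

theorem chartRep_congr {r : ℕ} (c : M) {w η : (x : M) → AltForm n r x}
    {y : EuclideanSpace ℝ (Fin n)}
    (h : w ((chartAt (EuclideanSpace ℝ (Fin n)) c).symm y) =
      η ((chartAt (EuclideanSpace ℝ (Fin n)) c).symm y)) :
    chartRep c w y = chartRep c η y := by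
  rw [chartRep, chartRep, h]

/-- At a point of `U`, either `w` is defined nearby or the cutoff function vanishes nearby. -/
theorem mem_chartDom_or_eventuallyEq_zero {f : M → ℝ} {U V : Opens M}
    (hV : ∀ x ∈ U, x ∈ tsupport f → x ∈ V) (c : M) {y : EuclideanSpace ℝ (Fin n)}
    (hy : y ∈ chartDom c U) :
    y ∈ chartDom c V ∨
      (fun z => f ((chartAt (EuclideanSpace ℝ (Fin n)) c).symm z)) =ᶠ[nhds y] 0 := by
  by_cases h : (chartAt (EuclideanSpace ℝ (Fin n)) c).symm y ∈ tsupport f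
  · exact Or.inl ⟨hy.1, hV _ hy.2 h⟩
  · exact Or.inr (((chartAt (EuclideanSpace ℝ (Fin n)) c).continuousAt_symm hy.1).eventually
      (notMem_tsupport_iff_eventuallyEq.1 h))

variable [IsManifold (𝓡 n) ∞ M]

theorem contDiffAt_comp_chart_symm {f : M → ℝ} (hf : ContMDiff (𝓡 n) 𝓘(ℝ) ∞ f) (c : M)
    {y : EuclideanSpace ℝ (Fin n)} (hy : y ∈ (chartAt (EuclideanSpace ℝ (Fin n)) c).target) :
    ContDiffAt ℝ ∞ (fun z => f ((chartAt (EuclideanSpace ℝ (Fin n)) c).symm z)) y := by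
  have h1 : ContMDiffAt (𝓡 n) (𝓡 n) ∞ (chartAt (EuclideanSpace ℝ (Fin n)) c).symm y :=
    (contMDiffOn_chart_symm (I := 𝓡 n) (n := ∞) (x := c)).contMDiffAt
      ((chartAt (EuclideanSpace ℝ (Fin n)) c).open_target.mem_nhds hy)
  exact ((hf _).comp y h1).contDiffAt

theorem contDiffAt_smul_chartRep {r : ℕ} {f : M → ℝ} (hf : ContMDiff (𝓡 n) 𝓘(ℝ) ∞ f)
    {U V : Opens M} (hV : ∀ x ∈ U, x ∈ tsupport f → x ∈ V) (w : Form n r V) (c : M)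
    {y : EuclideanSpace ℝ (Fin n)} (hy : y ∈ chartDom c U) :
    ContDiffAt ℝ ∞ (fun z => f ((chartAt (EuclideanSpace ℝ (Fin n)) c).symm z) •
      chartRep c (extendZero w.1) z) y := by
  rcases mem_chartDom_or_eventuallyEq_zero hV c hy with h | h
  · exact (contDiffAt_comp_chart_symm hf c hy.1).smul
      ((w.2 c).contDiffAt ((isOpen_chartDom c V).mem_nhds h))
  · refine (contDiffAt_const (c := 0)).congr_of_eventuallyEq (h.mono fun z hz => ?_)
    simp only [hz, Pi.zero_apply, zero_smul]

theorem chartRep_extendZero_d {r : ℕ} {V : Opens M} (w : Form n r V) (c : M)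
    {y : EuclideanSpace ℝ (Fin n)} (hy : y ∈ chartDom c V) :
    chartRep c (extendZero (Form.d w).1) y = extDeriv (chartRep c (extendZero w.1)) y := by
  rw [← chartRep_extDerivAt V (extendZero w.1) w.2 c y hy]
  exact chartRep_congr c (extendZero_of_mem _ hy.2)

/-- On `V` this is the Leibniz bound. At the other points of `U` the product vanishes nearby, so its
derivative is zero and the bound is trivial. -/
theorem norm_extDeriv_smul_chartRep_le {r : ℕ} {f : M → ℝ} (hf : ContMDiff (𝓡 n) 𝓘(ℝ) ∞ f)
    {U V : Opens M} (hV : ∀ x ∈ U, x ∈ tsupport f → x ∈ V) (w : Form n r V) (c : M)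
    {y : EuclideanSpace ℝ (Fin n)} (hy : y ∈ chartDom c U) :
    ‖extDeriv (fun z => f ((chartAt (EuclideanSpace ℝ (Fin n)) c).symm z) •
      chartRep c (extendZero w.1) z) y‖ ≤
      |f ((chartAt (EuclideanSpace ℝ (Fin n)) c).symm y)| * ‖chartRep c (extendZero (Form.d w).1) y‖ +
      (r + 1) * (‖fderiv ℝ (fun z => f ((chartAt (EuclideanSpace ℝ (Fin n)) c).symm z)) y‖ *
        ‖chartRep c (extendZero w.1) y‖) := by
  rcases mem_chartDom_or_eventuallyEq_zero hV c hy with h | h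
  · rw [chartRep_extendZero_d w c h]
    exact norm_extDeriv_fun_smul_le
      ((contDiffAt_comp_chart_symm hf c hy.1).differentiableAt (by simp))
      (((w.2 c).contDiffAt ((isOpen_chartDom c V).mem_nhds h)).differentiableAt (by simp))
  · have h0 : (fun z => f ((chartAt (EuclideanSpace ℝ (Fin n)) c).symm z) •
        chartRep c (extendZero w.1) z) =ᶠ[nhds y] fun _ => 0 :=
      h.mono fun z hz => by simp only [hz, Pi.zero_apply, zero_smul]
    have h1 : extDeriv (fun z => f ((chartAt (EuclideanSpace ℝ (Fin n)) c).symm z) •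
        chartRep c (extendZero w.1) z) y = 0 := by
      rw [h0.extDeriv_eq, extDeriv, fderiv_fun_const]
      exact map_zero (ContinuousAlternatingMap.alternatizeUncurryFinCLM (n := r) ℝ
        (EuclideanSpace ℝ (Fin n)) ℝ)
    rw [h1, norm_zero]
    positivity

end Cutoff

/-! ### The contracting homotopy -/

section Homotopy

variable {n N : ℕ} {M : Type*} [TopologicalSpace M] [ChartedSpace (EuclideanSpace ℝ (Fin n)) M]
  [IsManifold (𝓡 n) ∞ M] {U : Fin N → Opens M} {r s : ℕ}
  (ρ : SmoothPartitionOfUnity (Fin N) (𝓡 n) M univ)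

variable {ρ}

/-- The contracting homotopy `α_I = ∑ ρ_j β_{j, I}` of the Čech complex. -/
def homotopy (hρ : ρ.IsSubordinate (fun i => (U i : Set M))) (β : K n r (s + 1) U) : K n r s U :=
  fun I => ⟨fun x => ∑ j : Fin N, ρ j (x : M) • β.value (x : M) (Fin.cons j I), fun c => by
    have h : ContDiffOn ℝ ∞ (fun y => ∑ j : Fin N,
        ρ j ((chartAt (EuclideanSpace ℝ (Fin n)) c).symm y) •
          chartRep c (extendZero (β.component (Fin.cons j I)).1) y) (chartDom c (inter U I)) :=
      fun y hy => (ContDiffAt.sum fun j _ => contDiffAt_smul_chartRep (ρ j).contMDiff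
        (fun x hx hxj => mem_inter_cons (hρ j hxj) hx) _ c hy).contDiffWithinAt
    refine h.congr fun y hy => ?_
    rw [← chartRep_sum_smul Finset.univ c (fun j => ρ j)]
    exact chartRep_congr c (extendZero_of_mem _ hy.2)⟩

variable (hρ : ρ.IsSubordinate (fun i => (U i : Set M)))

theorem chartRep_homotopy (β : K n r (s + 1) U) (I : Fin s ↪o Fin N) (c : M)
    {y : EuclideanSpace ℝ (Fin n)} (hy : y ∈ chartDom c (inter U I)) :
    chartRep c (extendZero (homotopy hρ β I).1) y = ∑ j : Fin N,
      ρ j ((chartAt (EuclideanSpace ℝ (Fin n)) c).symm y) •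
        chartRep c (extendZero (β.component (Fin.cons j I)).1) y := by
  rw [← chartRep_sum_smul Finset.univ c (fun j => ρ j)]
  exact chartRep_congr c (extendZero_of_mem _ hy.2)

theorem extendZero_homotopy (β : K n r (s + 1) U) (I : Fin s ↪o Fin N) {x : M}
    (hx : x ∈ inter U I) : extendZero (homotopy hρ β I).1 x =
      ∑ j : Fin N, ρ j x • β.value x (Fin.cons j I) :=
  extendZero_of_mem _ hx

/-- After exchanging the sums, the j-th inner sum is ρ_j β_J: either ρ_j(x) = 0, or x ∈ U_j and the
cocycle identity applies. -/
theorem delta_homotopy {β : K n r (s + 1) U} (hβ : delta U r (s + 1) β = 0) :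
    delta U r s (homotopy hρ β) = β := by
  refine K.ext_apply fun J ⟨x, hx⟩ => ?_
  have hval : ∀ t : Fin (s + 1), (homotopy hρ β).value x (J ∘ t.succAbove) =
      ∑ j : Fin N, ρ j x • β.value x (Fin.cons j (J ∘ t.succAbove)) := fun t => by
    have hx' : x ∈ inter U ((Fin.succAboveOrderEmb t).trans J) :=
      inter_le_comp U J t.succAbove hx
    exact ((homotopy hρ β).value_coe x ((Fin.succAboveOrderEmb t).trans J)).trans
      (extendZero_homotopy hρ β _ hx')
  rw [delta_apply, cechSum]
  simp only [hval, Finset.smul_sum]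
  rw [Finset.sum_comm]
  have hj : ∀ j : Fin N, ∑ t : Fin (s + 1), (-1 : ℝ) ^ (t : ℕ) • ρ j x •
      β.value x (Fin.cons j (J ∘ t.succAbove)) = ρ j x • β.value x J := fun j => by
    by_cases h : ρ j x = 0
    · simp [h]
    · have hxj : x ∈ U j := hρ j (subset_tsupport _ h)
      rw [← sum_value_cons_of_delta_eq_zero hβ J hx hxj, Finset.smul_sum]
      exact Finset.sum_congr rfl fun t _ => smul_comm _ _ _
  rw [Finset.sum_congr rfl fun j _ => hj j, ← Finset.sum_smul]
  have h1 : ∑ j : Fin N, ρ j x = 1 := by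
    rw [← finsum_eq_sum_of_fintype]
    exact ρ.sum_eq_one (mem_univ x)
  rw [h1, one_smul, K.value_coe, extendZero_of_mem _ hx]

theorem norm_chartRep_d_homotopy_le (β : K n r (s + 1) U) (I : Fin s ↪o Fin N) (c : M)
    {y : EuclideanSpace ℝ (Fin n)} (hy : y ∈ chartDom c (inter U I)) :
    ‖chartRep c (extendZero (Form.d (homotopy hρ β I)).1) y‖ ≤ ∑ j : Fin N,
      (‖chartRep c (extendZero (Form.d (β.component (Fin.cons j I))).1) y‖ + (r + 1) *
        (‖fderiv ℝ (fun z => ρ j ((chartAt (EuclideanSpace ℝ (Fin n)) c).symm z)) y‖ *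
          ‖chartRep c (extendZero (β.component (Fin.cons j I)).1) y‖)) := by
  have hV : ∀ j : Fin N, ∀ x ∈ inter U I, x ∈ tsupport (ρ j) →
      x ∈ inter U (Fin.cons j I : Fin (s + 1) → Fin N) :=
    fun j x hx hxj => mem_inter_cons (hρ j hxj) hx
  have hev := Filter.eventually_of_mem ((isOpen_chartDom c (inter U I)).mem_nhds hy)
    (fun z hz => chartRep_homotopy hρ β I c hz)
  rw [chartRep_extendZero_d _ c hy, Filter.EventuallyEq.extDeriv_eq hev, extDeriv_fun_sum _
    fun j _ => (contDiffAt_smul_chartRep (ρ j).contMDiff (hV j) _ c hy).differentiableAt (by simp)]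
  refine (norm_sum_le _ _).trans (Finset.sum_le_sum fun j _ => ?_)
  refine (norm_extDeriv_smul_chartRep_le (ρ j).contMDiff (hV j) _ c hy).trans ?_
  gcongr
  refine mul_le_of_le_one_left (norm_nonneg _) ?_
  rw [abs_of_nonneg (ρ.nonneg j _)]
  exact ρ.le_one j _

end Homotopy

/-! ### Comparison of the Euclidean norm on forms with the operator norm -/

section AltNorm

variable {V W : Type*} [NormedAddCommGroup V] [InnerProductSpace ℝ V] [FiniteDimensional ℝ V]
  [NormedAddCommGroup W] [NormedSpace ℝ W] {r : ℕ}

theorem abs_apply_stdOrthonormalBasis_le (w : V [⋀^Fin r]→L[ℝ] ℝ)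
    (J : Fin r → Fin (Module.finrank ℝ V)) :
    |w fun k => stdOrthonormalBasis ℝ V (J k)| ≤ Real.sqrt r.factorial * altNorm w := by
  have hr : (0 : ℝ) < r.factorial := by exact_mod_cast r.factorial_pos
  rw [altNorm, ← Real.sqrt_mul hr.le, ← mul_assoc, mul_inv_cancel₀ hr.ne', one_mul,
    ← Real.sqrt_sq_eq_abs]
  exact Real.sqrt_le_sqrt (Finset.single_le_sum
    (f := fun J : Fin r → Fin (Module.finrank ℝ V) =>
      (w fun k => stdOrthonormalBasis ℝ V (J k)) ^ 2)
    (fun _ _ => sq_nonneg _) (Finset.mem_univ J))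

theorem altNorm_nonneg (w : V [⋀^Fin r]→L[ℝ] ℝ) : 0 ≤ altNorm w :=
  Real.sqrt_nonneg _

/-- Expand every argument in the orthonormal basis. There are (dim V)^r terms, each coefficient of
`w` is at most √(r!) `altNorm w`, and Cauchy–Schwarz bounds the coordinates. -/
theorem abs_apply_le_altNorm (w : V [⋀^Fin r]→L[ℝ] ℝ) (u : Fin r → V) :
    |w u| ≤ (Module.finrank ℝ V : ℝ) ^ r * Real.sqrt r.factorial * altNorm w * ∏ k, ‖u k‖ := by
  set e := stdOrthonormalBasis ℝ V
  have h1 : w u = ∑ J : Fin r → Fin (Module.finrank ℝ V),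
      (∏ k, inner ℝ (e (J k)) (u k)) * w fun k => e (J k) := by
    conv_lhs => rw [show u = fun k => ∑ i, inner ℝ (e i) (u k) • e i from
      funext fun k => (e.sum_repr' (u k)).symm]
    refine (w.toContinuousMultilinearMap.map_sum
      (fun k i => inner ℝ (e i) (u k) • e i)).trans (Finset.sum_congr rfl fun J _ => ?_)
    exact w.toContinuousMultilinearMap.map_smul_univ _ _
  have h2 : ∀ J : Fin r → Fin (Module.finrank ℝ V),
      |(∏ k, inner ℝ (e (J k)) (u k)) * w fun k => e (J k)| ≤
        (∏ k, ‖u k‖) * (Real.sqrt r.factorial * altNorm w) := fun J => by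
    rw [abs_mul, Finset.abs_prod]
    refine mul_le_mul (Finset.prod_le_prod (fun _ _ => abs_nonneg _) fun k _ => ?_)
      (abs_apply_stdOrthonormalBasis_le w J) (abs_nonneg _)
      (Finset.prod_nonneg fun _ _ => norm_nonneg _)
    refine (abs_real_inner_le_norm _ _).trans ?_
    rw [e.norm_eq_one, one_mul]
  rw [h1]
  refine (Finset.abs_sum_le_sum_abs _ _).trans ((Finset.sum_le_sum fun J _ => h2 J).trans ?_)
  rw [Finset.sum_const, Finset.card_univ, Fintype.card_fun, Fintype.card_fin, Fintype.card_fin,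
    nsmul_eq_mul, Nat.cast_pow]
  exact le_of_eq (by ring)

theorem altNorm_compContinuousLinearMap_le (w : W [⋀^Fin r]→L[ℝ] ℝ) (A : V →L[ℝ] W) {C : ℝ}
    (hC : 0 ≤ C) (hA : ∀ v, ‖A v‖ ≤ C * ‖v‖) :
    altNorm (w.compContinuousLinearMap A) ≤
      Real.sqrt ((r.factorial : ℝ)⁻¹ * (Module.finrank ℝ V : ℝ) ^ r) * C ^ r * ‖w‖ := by
  have hb : 0 ≤ C ^ r * ‖w‖ := by positivity
  rw [altNorm, mul_assoc, ← Real.sqrt_sq hb, ← Real.sqrt_mul (by positivity), mul_assoc]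
  refine Real.sqrt_le_sqrt (mul_le_mul_of_nonneg_left ?_ (by positivity))
  have h : ∀ J : Fin r → Fin (Module.finrank ℝ V),
      (w.compContinuousLinearMap A fun k => stdOrthonormalBasis ℝ V (J k)) ^ 2 ≤
        (C ^ r * ‖w‖) ^ 2 := fun J => by
    refine sq_le_sq' (neg_le_of_abs_le ?_) (le_of_abs_le ?_) <;>
    · refine (w.le_opNorm _).trans ?_
      rw [mul_comm]
      refine mul_le_mul_of_nonneg_right ?_ (norm_nonneg _)
      refine (Finset.prod_le_prod (fun _ _ => norm_nonneg _) (g := fun _ => C) fun k _ => ?_).trans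
        (by simp)
      refine (hA _).trans ?_
      rw [(stdOrthonormalBasis ℝ V).norm_eq_one, mul_one]
  refine (Finset.sum_le_sum fun J _ => h J).trans ?_
  rw [Finset.sum_const, Finset.card_univ, Fintype.card_fun, Fintype.card_fin, Fintype.card_fin,
    nsmul_eq_mul, Nat.cast_pow]

theorem norm_compContinuousLinearMap_le_altNorm (w : V [⋀^Fin r]→L[ℝ] ℝ) (B : W →L[ℝ] V) {C : ℝ}
    (hC : 0 ≤ C) (hB : ∀ v, ‖B v‖ ≤ C * ‖v‖) :
    ‖w.compContinuousLinearMap B‖ ≤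
      (Module.finrank ℝ V : ℝ) ^ r * Real.sqrt r.factorial * C ^ r * altNorm w := by
  have := altNorm_nonneg w
  refine ContinuousAlternatingMap.opNorm_le_bound _ (by positivity) fun v => ?_
  refine (abs_apply_le_altNorm w _).trans ?_
  have h : ∏ k, ‖(⇑B ∘ v) k‖ ≤ C ^ r * ∏ k, ‖v k‖ := by
    refine (Finset.prod_le_prod (fun _ _ => norm_nonneg _) fun k _ => hB (v k)).trans ?_
    rw [Finset.prod_mul_distrib]
    simp
  refine (mul_le_mul_of_nonneg_left h (by positivity)).trans (le_of_eq (by ring))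

theorem altNorm_zero : altNorm (0 : V [⋀^Fin r]→L[ℝ] ℝ) = 0 := by
  simp [altNorm]

theorem altNorm_smul (a : ℝ) (w : V [⋀^Fin r]→L[ℝ] ℝ) : altNorm (a • w) = |a| * altNorm w := by
  simp only [altNorm, ContinuousAlternatingMap.smul_apply, smul_eq_mul, mul_pow, ← Finset.mul_sum]
  rw [mul_left_comm, Real.sqrt_mul (sq_nonneg a), Real.sqrt_sq_eq_abs]

/-- The norm `altNorm` is, up to a factor, the `ℓ²` norm of the coefficients. -/
theorem altNorm_eq_norm (w : V [⋀^Fin r]→L[ℝ] ℝ) :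
    altNorm w = Real.sqrt (r.factorial : ℝ)⁻¹ * ‖WithLp.toLp 2
      fun J : Fin r → Fin (Module.finrank ℝ V) => w fun k => stdOrthonormalBasis ℝ V (J k)‖ := by
  rw [altNorm, Real.sqrt_mul (by positivity), EuclideanSpace.norm_eq]
  simp

theorem altNorm_add_le (w η : V [⋀^Fin r]→L[ℝ] ℝ) : altNorm (w + η) ≤ altNorm w + altNorm η := by
  simp only [altNorm_eq_norm, ← mul_add]
  exact mul_le_mul_of_nonneg_left (norm_add_le (WithLp.toLp 2 _) (WithLp.toLp 2 _))
    (Real.sqrt_nonneg _)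

end AltNorm

/-! ### Comparison of the Riemannian norm with the norm in a chart -/

section PointNorm

variable {n : ℕ} {M : Type*} [TopologicalSpace M] [ChartedSpace (EuclideanSpace ℝ (Fin n)) M]
  [RiemannianBundle (fun x : M => TangentSpace (𝓡 n) x)] {r : ℕ}

theorem pointNorm_nonneg (x : M) (w : AltForm n r x) : 0 ≤ pointNorm x w :=
  Real.sqrt_nonneg _

theorem pointNorm_zero (x : M) : pointNorm x (0 : AltForm n r x) = 0 :=
  haveI : FiniteDimensional ℝ (TangentSpace (𝓡 n) x) :=
    inferInstanceAs (FiniteDimensional ℝ (EuclideanSpace ℝ (Fin n)))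
  altNorm_zero

theorem pointNorm_smul (x : M) (a : ℝ) (w : AltForm n r x) :
    pointNorm x (a • w) = |a| * pointNorm x w :=
  haveI : FiniteDimensional ℝ (TangentSpace (𝓡 n) x) :=
    inferInstanceAs (FiniteDimensional ℝ (EuclideanSpace ℝ (Fin n)))
  altNorm_smul a w

theorem pointNorm_add_le (x : M) (w η : AltForm n r x) :
    pointNorm x (w + η) ≤ pointNorm x w + pointNorm x η :=
  haveI : FiniteDimensional ℝ (TangentSpace (𝓡 n) x) :=
    inferInstanceAs (FiniteDimensional ℝ (EuclideanSpace ℝ (Fin n)))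
  altNorm_add_le w η

theorem pointNorm_sum_le {ι : Type*} (t : Finset ι) (x : M) (w : ι → AltForm n r x) :
    pointNorm x (∑ i ∈ t, w i) ≤ ∑ i ∈ t, pointNorm x (w i) :=
  Finset.le_sum_of_subadditive _ (pointNorm_zero x).le (pointNorm_add_le x) t w

variable [IsManifold (𝓡 n) ∞ M] [IsContMDiffRiemannianBundle (𝓡 n) ∞ (EuclideanSpace ℝ (Fin n))
      (fun x : M => TangentSpace (𝓡 n) x)]

variable (n M) in
theorem isContinuousRiemannianBundle : IsContinuousRiemannianBundle (EuclideanSpace ℝ (Fin n))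
    (fun x : M => TangentSpace (𝓡 n) x) := by
  obtain ⟨g, hg, h⟩ := IsContMDiffRiemannianBundle.exists_contMDiff (IB := 𝓡 n) (n := ∞)
    (F := EuclideanSpace ℝ (Fin n)) (E := fun x : M => TangentSpace (𝓡 n) x)
  exact ⟨⟨g, hg.continuous, h⟩⟩

theorem exists_norm_mfderiv_chart_le (c : M) : ∃ C : ℝ, 0 ≤ C ∧ ∀ᶠ x in nhds c,
    ∀ v : TangentSpace (𝓡 n) x, @norm (EuclideanSpace ℝ (Fin n)) _
      (mfderiv (𝓡 n) (𝓡 n) (chartAt (EuclideanSpace ℝ (Fin n)) c) x v) ≤ C * ‖v‖ := by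
  let _ (y : EuclideanSpace ℝ (Fin n)) :=
    normedAddCommGroupTangentSpaceVectorSpace (E := EuclideanSpace ℝ (Fin n)) y
  let _ (y : EuclideanSpace ℝ (Fin n)) :=
    normedSpaceTangentSpaceVectorSpace (E := EuclideanSpace ℝ (Fin n)) y
  have := isContinuousRiemannianBundle n M
  obtain ⟨C, hC, h⟩ := eventually_norm_mfderiv_extChartAt_lt (𝓡 n) c
  refine ⟨C, hC.le, h.mono fun x hx v => ?_⟩
  exact ((mfderiv (𝓡 n) (𝓡 n) (extChartAt (𝓡 n) c) x).le_opNorm v).trans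
    (mul_le_mul_of_nonneg_right hx.le (norm_nonneg v))

theorem exists_norm_mfderiv_chart_symm_le (c : M) : ∃ C : ℝ, 0 ≤ C ∧ ∀ᶠ x in nhds c,
    ∀ v : EuclideanSpace ℝ (Fin n),
      ‖(mfderiv (𝓡 n) (𝓡 n) (chartAt (EuclideanSpace ℝ (Fin n)) c).symm
        (chartAt (EuclideanSpace ℝ (Fin n)) c x) v : TangentSpace (𝓡 n)
          ((chartAt (EuclideanSpace ℝ (Fin n)) c).symm
            (chartAt (EuclideanSpace ℝ (Fin n)) c x)))‖ ≤ C * ‖v‖ := by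
  let _ (y : EuclideanSpace ℝ (Fin n)) :=
    normedAddCommGroupTangentSpaceVectorSpace (E := EuclideanSpace ℝ (Fin n)) y
  let _ (y : EuclideanSpace ℝ (Fin n)) :=
    normedSpaceTangentSpaceVectorSpace (E := EuclideanSpace ℝ (Fin n)) y
  have := isContinuousRiemannianBundle n M
  obtain ⟨C, hC, h⟩ := eventually_norm_mfderivWithin_symm_extChartAt_comp_lt (𝓡 n) c
  refine ⟨C, hC.le, h.mono fun x hx v => ?_⟩
  -- The model has no boundary, so the derivative within its range is the full derivative.
  rw [ModelWithCorners.range_eq_univ, mfderivWithin_univ] at hx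
  exact ((mfderiv (𝓡 n) (𝓡 n) (extChartAt (𝓡 n) c).symm (extChartAt (𝓡 n) c x)).le_opNorm v).trans
    (mul_le_mul_of_nonneg_right hx.le (norm_nonneg v))

omit [RiemannianBundle (fun x : M => TangentSpace (𝓡 n) x)] in
-- Chain rule for φ⁻¹ ∘ φ = id near x: pulling back by φ undoes the pullback by φ⁻¹.
theorem chartRep_compContinuousLinearMap_mfderiv (c : M) (w : (x : M) → AltForm n r x) {x : M}
    (hx : x ∈ (chartAt (EuclideanSpace ℝ (Fin n)) c).source) :
    (chartRep c w (chartAt (EuclideanSpace ℝ (Fin n)) c x)).compContinuousLinearMap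
      (mfderiv (𝓡 n) (𝓡 n) (chartAt (EuclideanSpace ℝ (Fin n)) c) x) = w x := by
  set φ := chartAt (EuclideanSpace ℝ (Fin n)) c
  have h1 : MDifferentiableAt (𝓡 n) (𝓡 n) φ x :=
    mdifferentiableAt_atlas (chart_mem_atlas _ c) hx
  have h2 : MDifferentiableAt (𝓡 n) (𝓡 n) φ.symm (φ x) :=
    mdifferentiableAt_atlas_symm (chart_mem_atlas _ c) (φ.map_source hx)
  have h3 : mfderiv (𝓡 n) (𝓡 n) (φ.symm ∘ φ) x =
      (mfderiv (𝓡 n) (𝓡 n) φ.symm (φ x)).comp (mfderiv (𝓡 n) (𝓡 n) φ x) :=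
    mfderiv_comp x h2 h1
  have h4 : (φ.symm ∘ φ) =ᶠ[nhds x] id :=
    Filter.eventually_of_mem (φ.open_source.mem_nhds hx) fun q hq => φ.left_inv hq
  have h5 : mfderiv (𝓡 n) (𝓡 n) (φ.symm ∘ φ) x =
      ContinuousLinearMap.id ℝ (EuclideanSpace ℝ (Fin n)) :=
    h4.mfderiv_eq.trans mfderiv_id
  have hgen : ∀ (p q : M) (_ : p = q)
      (A B : EuclideanSpace ℝ (Fin n) →L[ℝ] EuclideanSpace ℝ (Fin n)) (_ : A = B),
      ContinuousAlternatingMap.compContinuousLinearMap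
        (w p : EuclideanSpace ℝ (Fin n) [⋀^Fin r]→L[ℝ] ℝ) A =
      ContinuousAlternatingMap.compContinuousLinearMap
        (w q : EuclideanSpace ℝ (Fin n) [⋀^Fin r]→L[ℝ] ℝ) B := by
    rintro p q rfl A B rfl; rfl
  exact hgen _ _ (φ.left_inv hx) _ _ (h3.symm.trans h5)

/-- Near the centre of a chart, the pointwise norm is comparable to the norm of the expression in
the chart. -/
theorem exists_pointNorm_equiv_norm_chartRep (r : ℕ) (c : M) : ∃ C : ℝ, 0 ≤ C ∧
    ∀ᶠ x in nhds c, ∀ w : (x : M) → AltForm n r x,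
      pointNorm x (w x) ≤ C * ‖chartRep c w (chartAt (EuclideanSpace ℝ (Fin n)) c x)‖ ∧
      ‖chartRep c w (chartAt (EuclideanSpace ℝ (Fin n)) c x)‖ ≤ C * pointNorm x (w x) := by
  obtain ⟨A, hA, h1⟩ := exists_norm_mfderiv_chart_le (n := n) c
  obtain ⟨B, hB, h2⟩ := exists_norm_mfderiv_chart_symm_le (n := n) c
  set a := Real.sqrt ((r.factorial : ℝ)⁻¹ * (n : ℝ) ^ r) * A ^ r with ha
  set b := (n : ℝ) ^ r * Real.sqrt r.factorial * B ^ r with hb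
  have hfr : ∀ x : M, Module.finrank ℝ (TangentSpace (𝓡 n) x) = n :=
    fun _ => finrank_euclideanSpace_fin
  have hfd : ∀ x : M, FiniteDimensional ℝ (TangentSpace (𝓡 n) x) :=
    fun _ => inferInstanceAs (FiniteDimensional ℝ (EuclideanSpace ℝ (Fin n)))
  refine ⟨max a b, le_max_of_le_left (by positivity), ?_⟩
  filter_upwards [h1, h2, chart_source_mem_nhds (EuclideanSpace ℝ (Fin n)) c] with x hx1 hx2 hxs w
  constructor
  · refine le_trans ?_ (mul_le_mul_of_nonneg_right (le_max_left a b) (norm_nonneg _))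
    have h := altNorm_compContinuousLinearMap_le (V := TangentSpace (𝓡 n) x)
      (W := EuclideanSpace ℝ (Fin n))
      (chartRep c w (chartAt (EuclideanSpace ℝ (Fin n)) c x))
      (mfderiv (𝓡 n) (𝓡 n) (chartAt (EuclideanSpace ℝ (Fin n)) c) x) hA hx1
    rw [hfr] at h
    refine le_trans (le_of_eq ?_) h
    exact congrArg (fun w' : AltForm n r x => pointNorm x w')
      (chartRep_compContinuousLinearMap_mfderiv c w hxs).symm
  · refine le_trans ?_ (mul_le_mul_of_nonneg_right (le_max_right a b) (pointNorm_nonneg _ _))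
    -- The point φ⁻¹(φ x) is equal to x but not definitionally, and the fibre depends on it; hence
    -- the detour through a general `p`.
    have hp : ∀ p : M, p = x → pointNorm p (w p) = pointNorm x (w x) := by rintro _ rfl; rfl
    rw [← hp _ ((chartAt (EuclideanSpace ℝ (Fin n)) c).left_inv hxs)]
    have h := norm_compContinuousLinearMap_le_altNorm
      (V := TangentSpace (𝓡 n) ((chartAt (EuclideanSpace ℝ (Fin n)) c).symm
        (chartAt (EuclideanSpace ℝ (Fin n)) c x)))
      (W := EuclideanSpace ℝ (Fin n)) (w _)
      (mfderiv (𝓡 n) (𝓡 n) (chartAt (EuclideanSpace ℝ (Fin n)) c).symm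
        (chartAt (EuclideanSpace ℝ (Fin n)) c x)) hB hx2
    rw [hfr] at h
    exact h

end PointNorm

/-! ### Minkowski's inequality and measurable majorants -/

section Lp

/-- Minkowski's inequality up to a constant, for functions that are comparable to measurable
functions. -/
theorem lintegral_rpow_le_of_le_sum {X ι : Type*} [MeasurableSpace X] {μ : Measure X} {p : ℝ}
    (hp : 1 ≤ p) (t : Finset ι) {F : X → ℝ≥0∞} {f g : ι → X → ℝ≥0∞} {A C : ℝ≥0}
    (hF : ∀ x, F x ≤ A * ∑ i ∈ t, f i x) (hg : ∀ i ∈ t, Measurable (g i))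
    (hfg : ∀ i ∈ t, ∀ x, f i x ≤ g i x) (hgf : ∀ i ∈ t, ∀ x, g i x ≤ C * f i x) :
    (∫⁻ x, F x ^ p ∂μ) ^ (1 / p) ≤
      (A * C : ℝ≥0) * ∑ i ∈ t, (∫⁻ x, f i x ^ p ∂μ) ^ (1 / p) := by
  have hp0 : 0 < p := zero_lt_one.trans_le hp
  have hscale : ∀ (a : ℝ≥0) (h : X → ℝ≥0∞),
      (∫⁻ x, (a * h x) ^ p ∂μ) ^ (1 / p) = a * (∫⁻ x, h x ^ p ∂μ) ^ (1 / p) := fun a h => by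
    simp only [ENNReal.mul_rpow_of_nonneg _ _ hp0.le]
    rw [lintegral_const_mul' _ _ (ENNReal.rpow_ne_top_of_nonneg hp0.le ENNReal.coe_ne_top),
      ENNReal.mul_rpow_of_nonneg _ _ (by positivity), ← ENNReal.rpow_mul,
      mul_one_div_cancel hp0.ne', ENNReal.rpow_one]
  have hmono : ∀ {h k : X → ℝ≥0∞}, (∀ x, h x ≤ k x) →
      (∫⁻ x, h x ^ p ∂μ) ^ (1 / p) ≤ (∫⁻ x, k x ^ p ∂μ) ^ (1 / p) := fun hhk =>
    ENNReal.rpow_le_rpow (lintegral_mono fun x => ENNReal.rpow_le_rpow (hhk x) hp0.le)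
      (by positivity)
  have hsum : (∫⁻ x, (∑ i ∈ t, g i) x ^ p ∂μ) ^ (1 / p) ≤
      ∑ i ∈ t, (∫⁻ x, g i x ^ p ∂μ) ^ (1 / p) :=
    Finset.le_sum_of_subadditive_on_pred (fun h : X → ℝ≥0∞ => (∫⁻ x, h x ^ p ∂μ) ^ (1 / p))
      Measurable (by simp [hp0])
      (fun h k hh hk => ENNReal.lintegral_Lp_add_le hh.aemeasurable hk.aemeasurable hp)
      (fun _ _ hh hk => hh.add hk) g hg
  calc (∫⁻ x, F x ^ p ∂μ) ^ (1 / p)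
      ≤ (∫⁻ x, (A * (∑ i ∈ t, g i) x) ^ p ∂μ) ^ (1 / p) := hmono fun x => (hF x).trans (by
        rw [Finset.sum_apply]
        gcongr with i hi
        exact hfg i hi x)
    _ ≤ A * ∑ i ∈ t, (∫⁻ x, g i x ^ p ∂μ) ^ (1 / p) := by
        rw [hscale]
        gcongr
    _ ≤ A * ∑ i ∈ t, C * (∫⁻ x, f i x ^ p ∂μ) ^ (1 / p) := by
        gcongr with i hi
        rw [← hscale]
        exact hmono (hgf i hi)
    _ = (A * C : ℝ≥0) * ∑ i ∈ t, (∫⁻ x, f i x ^ p ∂μ) ^ (1 / p) := by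
        rw [← Finset.mul_sum, ← mul_assoc, ENNReal.coe_mul]

/-- On a compact space, a local bound gives a uniform one. -/
theorem exists_forall_of_eventually {X : Type*} [TopologicalSpace X] [CompactSpace X]
    {P : ℝ → X → Prop} (hmono : ∀ {a b : ℝ} {x : X}, a ≤ b → P a x → P b x)
    (h : ∀ c, ∃ a : ℝ, ∀ᶠ x in nhds c, P a x) : ∃ a : ℝ, 0 ≤ a ∧ ∀ x, P a x := by
  have key : ∃ a : ℝ, 0 ≤ a ∧ ∀ x ∈ (univ : Set X), P a x := by
    refine isCompact_univ.induction_on (p := fun S => ∃ a : ℝ, 0 ≤ a ∧ ∀ x ∈ S, P a x)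
      ⟨0, le_rfl, fun _ hx => hx.elim⟩ ?_ ?_ ?_
    · rintro S T hST ⟨a, ha, haT⟩
      exact ⟨a, ha, fun x hx => haT x (hST hx)⟩
    · rintro S T ⟨a, ha, haS⟩ ⟨b, hb, hbT⟩
      refine ⟨max a b, le_max_of_le_left ha, fun x hx => ?_⟩
      exact hx.elim (fun h => hmono (le_max_left a b) (haS x h))
        (fun h => hmono (le_max_right a b) (hbT x h))
    · intro c _
      obtain ⟨a, ha⟩ := h c
      exact ⟨_, mem_nhdsWithin_of_mem_nhds ha, max a 0, le_max_right a 0,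
        fun x hx => hmono (le_max_left a 0) hx⟩
  simpa using key

variable {n : ℕ} {M : Type*} [TopologicalSpace M] [ChartedSpace (EuclideanSpace ℝ (Fin n)) M]
  [IsManifold (𝓡 n) ∞ M] [RiemannianBundle (fun x : M => TangentSpace (𝓡 n) x)]
  [IsContMDiffRiemannianBundle (𝓡 n) ∞ (EuclideanSpace ℝ (Fin n))
      (fun x : M => TangentSpace (𝓡 n) x)] [CompactSpace M]

variable (n M) in
/-- The pointwise norm of a smooth form is comparable to a measurable function, uniformly in the
form. -/
theorem exists_measurable_equiv_pointNorm [MeasurableSpace M] [BorelSpace M] (r : ℕ) :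
    ∃ C : ℝ≥0, ∀ (V : Opens M) (w : Form n r V), ∃ g : M → ℝ≥0∞, Measurable g ∧
      (∀ x, ENNReal.ofReal (pointNorm x (extendZero w.1 x)) ≤ g x) ∧
      ∀ x, g x ≤ C * ENNReal.ofReal (pointNorm x (extendZero w.1 x)) := by
  choose C hC h using exists_pointNorm_equiv_norm_chartRep (n := n) (M := M) r
  have hO : ∀ c : M, ∃ O : Set M, IsOpen O ∧ c ∈ O ∧
      O ⊆ (chartAt (EuclideanSpace ℝ (Fin n)) c).source ∧
      ∀ x ∈ O, ∀ w : (x : M) → AltForm n r x,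
        pointNorm x (w x) ≤ C c * ‖chartRep c w (chartAt (EuclideanSpace ℝ (Fin n)) c x)‖ ∧
        ‖chartRep c w (chartAt (EuclideanSpace ℝ (Fin n)) c x)‖ ≤ C c * pointNorm x (w x) := by
    intro c
    obtain ⟨O, hO, hOo, hcO⟩ := mem_nhds_iff.1
      ((h c).and (chart_source_mem_nhds (EuclideanSpace ℝ (Fin n)) c))
    exact ⟨O, hOo, hcO, fun x hx => (hO hx).2, fun x hx => (hO hx).1⟩
  choose O hOo hcO hOs hOb using hO
  obtain ⟨t, ht⟩ := CompactSpace.elim_nhds_subcover O fun c => (hOo c).mem_nhds (hcO c)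
  -- The majorant is a finite sum, over a subcover, of chart norms scaled by C_c and cut off to O_c
  -- ∩ V, where they are continuous. One summand already dominates the pointwise norm, and each is
  -- at most C_c² times it.
  refine ⟨∑ c ∈ t, (C c * C c).toNNReal, fun V w => ?_⟩
  let k : M → M → ℝ≥0∞ := fun c x => ENNReal.ofReal (C c *
    ‖chartRep c (extendZero w.1) (chartAt (EuclideanSpace ℝ (Fin n)) c x)‖)
  refine ⟨fun x => ∑ c ∈ t, (O c ∩ V).indicator (k c) x, ?_, fun x => ?_, fun x => ?_⟩
  · refine Finset.measurable_fun_sum _ fun c _ => ?_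
    have hcont : ContinuousOn (k c) (O c ∩ V) := by
      refine ENNReal.continuous_ofReal.comp_continuousOn (continuousOn_const.mul ?_)
      refine ContinuousOn.norm ((w.2 c).continuousOn.comp
        ((chartAt (EuclideanSpace ℝ (Fin n)) c).continuousOn.mono
          (inter_subset_left.trans (hOs c))) fun x hx => ?_)
      refine ⟨(chartAt (EuclideanSpace ℝ (Fin n)) c).map_source (hOs c hx.1), ?_⟩
      rw [mem_preimage, (chartAt (EuclideanSpace ℝ (Fin n)) c).left_inv (hOs c hx.1)]
      exact hx.2
    classical
    rw [← piecewise_eq_indicator]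
    exact hcont.measurable_piecewise continuousOn_const
      ((hOo c).inter V.isOpen).measurableSet
  · by_cases hx : x ∈ V
    · obtain ⟨c, hct, hxc⟩ : ∃ c ∈ t, x ∈ O c := by
        have : x ∈ ⋃ c ∈ t, O c := ht ▸ mem_univ x
        simpa using this
      refine le_trans ?_ (Finset.single_le_sum (fun _ _ => zero_le) hct)
      rw [indicator_of_mem (show x ∈ O c ∩ V from ⟨hxc, hx⟩)]
      exact ENNReal.ofReal_le_ofReal (hOb c x hxc _).1
    · rw [extendZero_of_notMem _ hx, pointNorm_zero, ENNReal.ofReal_zero]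
      exact zero_le
  · rw [ENNReal.ofNNReal_finsetSum, Finset.sum_mul]
    refine Finset.sum_le_sum fun c _ => ?_
    by_cases hx : x ∈ O c ∩ V
    · rw [indicator_of_mem hx]
      refine (ENNReal.ofReal_le_ofReal (mul_le_mul_of_nonneg_left (hOb c x hx.1 _).2 (hC c))).trans ?_
      rw [← mul_assoc, ENNReal.ofReal_mul (mul_nonneg (hC c) (hC c))]
      rfl
    · rw [indicator_of_notMem hx]
      exact zero_le

end Lp

/-! ### Estimates for the homotopy -/

section Estimates

variable {n N : ℕ} {M : Type*} [TopologicalSpace M] [ChartedSpace (EuclideanSpace ℝ (Fin n)) M]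
  {U : Fin N → Opens M} {r s : ℕ}

theorem extDerivAt_smul (a : ℝ) (w : (x : M) → AltForm n r x) (x : M) :
    extDerivAt (a • w) x = a • extDerivAt w x := by
  have h : chartRep x (a • w) = a • chartRep x w := rfl
  rw [extDerivAt, extDerivAt, h, extDeriv_smul]
  rfl

/-- The exterior derivative commutes with taking components. -/
theorem extendZero_d_component [IsManifold (𝓡 n) ∞ M] (β : K n r s U) (J : Fin s → Fin N) (x : M) :
    extendZero (Form.d (β.component J)).1 x = (K.d β).value x J := by
  by_cases hx : x ∈ inter U J
  · have hd : ∀ {V : Opens M} (w : Form n r V), x ∈ V →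
        extendZero (Form.d w).1 x = extDerivAt (extendZero w.1) x := fun w hxV =>
      extendZero_of_mem _ hxV
    rw [hd _ hx]
    by_cases hJ : Function.Injective J
    · obtain ⟨σ, I, h⟩ := exists_perm_comp_eq hJ
      have hxI : x ∈ inter U I := h ▸ inter_le_comp U J σ hx
      -- Equality is needed on all of M, not just at x, because `extDerivAt` depends on the form
      -- near x.
      have h1 : extendZero (β.component J).1 =
          ((Equiv.Perm.sign σ : ℤ) : ℝ) • extendZero (β I).1 :=
        funext fun z => β.value_of_comp z J I σ h
      rw [h1, extDerivAt_smul, (K.d β).value_of_comp x J I σ h]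
      exact congrArg _ (hd _ hxI).symm
    · have h1 : extendZero (β.component J).1 = (0 : ℝ) • extendZero (β.component J).1 :=
        funext fun z => (β.value_zero z hJ).trans (zero_smul ℝ _).symm
      rw [h1, extDerivAt_smul, zero_smul, K.value_zero _ _ hJ]
  · rw [K.value, extendZero_of_notMem _ hx, extendZero_of_notMem _ hx]

variable [RiemannianBundle (fun x : M => TangentSpace (𝓡 n) x)]

/-- Up to a sign, a component with distinct indices is one of the summands of the norm, extended by
zero; with a repeated index it vanishes. -/
theorem lintegral_value_le [MeasurableSpace M] [BorelSpace M] {p : ℝ} (hp : 1 ≤ p)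
    (γ : K n r s U) (J : Fin s → Fin N) (S : Set M) :
    (∫⁻ x in S, ENNReal.ofReal (pointNorm x (γ.value x J)) ^ p ∂(riemannianVolume n M)) ^ (1 / p) ≤
      γ.lpNorm p := by
  have hp0 : 0 < p := zero_lt_one.trans_le hp
  by_cases hJ : Function.Injective J
  · obtain ⟨σ, I, h⟩ := exists_perm_comp_eq hJ
    refine le_trans ?_ (Finset.single_le_sum (fun _ _ => zero_le) (Finset.mem_univ I))
    refine ENNReal.rpow_le_rpow ((setLIntegral_le_lintegral S _).trans ?_) (by positivity)
    rw [← lintegral_indicator (inter U I).isOpen.measurableSet]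
    refine lintegral_mono fun x => ?_
    have hsign : |((Equiv.Perm.sign σ : ℤ) : ℝ)| = 1 := by
      rw [← Int.cast_abs]
      simp
    rw [γ.value_of_comp x J I σ h, pointNorm_smul, hsign, one_mul]
    by_cases hx : x ∈ inter U I
    · rw [indicator_of_mem (show x ∈ (inter U I : Set M) from hx)]
    · rw [extendZero_of_notMem _ hx, pointNorm_zero, ENNReal.ofReal_zero,
        ENNReal.zero_rpow_of_pos hp0]
      exact zero_le
  · simp only [γ.value_zero _ hJ, pointNorm_zero, ENNReal.ofReal_zero,
      ENNReal.zero_rpow_of_pos hp0, lintegral_zero]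
    rw [ENNReal.zero_rpow_of_pos (by positivity)]
    exact zero_le

variable [IsManifold (𝓡 n) ∞ M] {ρ : SmoothPartitionOfUnity (Fin N) (𝓡 n) M univ}
  (hρ : ρ.IsSubordinate (fun i => (U i : Set M)))

theorem pointNorm_homotopy_le (β : K n r (s + 1) U) (I : Fin s ↪o Fin N) (x : M) :
    pointNorm x (extendZero (homotopy hρ β I).1 x) ≤
      ∑ j : Fin N, pointNorm x (β.value x (Fin.cons j I)) := by
  by_cases hx : x ∈ inter U I
  · rw [extendZero_homotopy hρ β I hx]
    refine (pointNorm_sum_le _ _ _).trans (Finset.sum_le_sum fun j _ => ?_)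
    rw [pointNorm_smul, abs_of_nonneg (ρ.nonneg j x)]
    exact mul_le_of_le_one_left (pointNorm_nonneg _ _) (ρ.le_one j x)
  · rw [extendZero_of_notMem _ hx, pointNorm_zero]
    exact Finset.sum_nonneg fun _ _ => pointNorm_nonneg _ _

variable [IsContMDiffRiemannianBundle (𝓡 n) ∞ (EuclideanSpace ℝ (Fin n))
      (fun x : M => TangentSpace (𝓡 n) x)] [CompactSpace M]

/-- The chart estimate for d(∑ ρ_j β_{jI}) translates to pointwise norms near `c`, where the
derivatives of the ρ_j are bounded by continuity; compactness makes the constant uniform. -/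
theorem exists_pointNorm_d_homotopy_le (r s : ℕ) : ∃ C : ℝ, 0 ≤ C ∧
    ∀ (x : M) (β : K n r (s + 1) U) (I : Fin s ↪o Fin N),
      pointNorm x (extendZero (Form.d (homotopy hρ β I)).1 x) ≤
        C * ∑ j : Fin N, (pointNorm x (β.value x (Fin.cons j I)) +
          pointNorm x ((K.d β).value x (Fin.cons j I))) := by
  refine exists_forall_of_eventually (fun {a b x} hab h β I => (h β I).trans
    (mul_le_mul_of_nonneg_right hab (Finset.sum_nonneg fun _ _ =>
      add_nonneg (pointNorm_nonneg _ _) (pointNorm_nonneg _ _)))) fun c => ?_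
  obtain ⟨A, hA, h1⟩ := exists_pointNorm_equiv_norm_chartRep (n := n) r c
  obtain ⟨B, hB, h2⟩ := exists_pointNorm_equiv_norm_chartRep (n := n) (r + 1) c
  set φ := chartAt (EuclideanSpace ℝ (Fin n)) c with hφ
  have hD : ∀ j : Fin N, ∃ D : ℝ, ∀ᶠ x in nhds c, ‖fderiv ℝ (fun z => ρ j (φ.symm z)) (φ x)‖ ≤ D :=
    fun j => by
      have h3 : ContDiffAt ℝ ∞ (fun z => ρ j (φ.symm z)) (φ c) :=
        contDiffAt_comp_chart_symm (ρ j).contMDiff c (mem_chart_target _ c)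
      have h4 : ContinuousAt (fun x => ‖fderiv ℝ (fun z => ρ j (φ.symm z)) (φ x)‖) c :=
        ((h3.fderiv_right (m := 0) (by simp)).continuousAt.comp
          (φ.continuousAt (mem_chart_source _ c))).norm
      exact ⟨_, (h4.eventually (gt_mem_nhds (lt_add_one _))).mono fun _ h => h.le⟩
  choose D hD using hD
  set D' := ∑ j, |D j| with hD'
  have hDD : ∀ j, D j ≤ D' := fun j => (le_abs_self _).trans
    (Finset.single_le_sum (f := fun j => |D j|) (fun _ _ => abs_nonneg _) (Finset.mem_univ j))
  have hD0 : 0 ≤ D' := Finset.sum_nonneg fun _ _ => abs_nonneg _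
  -- In the chart, each j contributes at most B |dβ_{jI}| + (r + 1) D' A |β_{jI}|. The outer `B`
  -- returns to the pointwise norm of an (r + 1)-form.
  refine ⟨B * (B + (r + 1) * (D' * A)), ?_⟩
  filter_upwards [h1, h2, Filter.eventually_all.2 hD,
    chart_source_mem_nhds (EuclideanSpace ℝ (Fin n)) c] with x hx1 hx2 hx3 hxs β I
  by_cases hx : x ∈ inter U I
  · have hy : φ x ∈ chartDom c (inter U I) := by
      refine ⟨φ.map_source hxs, ?_⟩
      rw [mem_preimage, φ.left_inv hxs]
      exact hx
    refine (hx2 _).1.trans ?_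
    rw [mul_assoc]
    refine mul_le_mul_of_nonneg_left
      ((norm_chartRep_d_homotopy_le hρ β I c hy).trans ?_) hB
    rw [Finset.mul_sum]
    refine Finset.sum_le_sum fun j _ => ?_
    have e1 := (hx1 (extendZero (β.component (Fin.cons j I)).1)).2
    have e2 := (hx2 (extendZero (Form.d (β.component (Fin.cons j I))).1)).2
    rw [extendZero_d_component] at e2
    change _ ≤ A * pointNorm x (β.value x (Fin.cons j I)) at e1
    have e3 : ‖fderiv ℝ (fun z => ρ j (φ.symm z)) (φ x)‖ ≤ D' := (hx3 j).trans (hDD j)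
    have p1 := pointNorm_nonneg x (β.value x (Fin.cons j I))
    have p2 := pointNorm_nonneg x ((K.d β).value x (Fin.cons j I))
    have e4 := mul_le_mul e3 e1 (norm_nonneg _) hD0
    have e5 := mul_le_mul_of_nonneg_left e4 (show (0 : ℝ) ≤ r + 1 by positivity)
    refine (add_le_add e2 e5).trans ?_
    have q1 : 0 ≤ B * pointNorm x (β.value x (Fin.cons j I)) := mul_nonneg hB p1
    have q2 : 0 ≤ ((r : ℝ) + 1) * (D' * A) * pointNorm x ((K.d β).value x (Fin.cons j I)) := by
      positivity
    linarith
  · rw [extendZero_of_notMem _ hx, pointNorm_zero]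
    have : 0 ≤ ∑ j : Fin N, (pointNorm x (β.value x (Fin.cons j I)) +
        pointNorm x ((K.d β).value x (Fin.cons j I))) :=
      Finset.sum_nonneg fun _ _ => add_nonneg (pointNorm_nonneg _ _) (pointNorm_nonneg _ _)
    positivity

variable [MeasurableSpace M] [BorelSpace M]

theorem exists_lpNorm_homotopy_le (r s : ℕ) {p : ℝ} (hp : 1 ≤ p) :
    ∃ C : ℝ≥0, ∀ β : K n r (s + 1) U, (homotopy hρ β).lpNorm p ≤ C * β.lpNorm p := by
  obtain ⟨C, hC⟩ := exists_measurable_equiv_pointNorm n M r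
  -- Each of the N terms of a component is bounded by the whole norm of β, and the components are
  -- then counted.
  refine ⟨Fintype.card (Fin s ↪o Fin N) * (C * N), fun β => ?_⟩
  have h : ∀ I : Fin s ↪o Fin N, Form.lpNorm p (homotopy hρ β I) ≤ C * (N * β.lpNorm p) := by
    intro I
    choose g hg hfg hgf using fun j : Fin N => hC _ (β.component (Fin.cons j I))
    refine (lintegral_rpow_le_of_le_sum hp Finset.univ (A := 1) (C := C) (g := g)
      (f := fun j x => ENNReal.ofReal (pointNorm x (β.value x (Fin.cons j I))))
      (fun x => ?_) (fun j _ => hg j) (fun j _ => hfg j) (fun j _ => hgf j)).trans ?_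
    · rw [ENNReal.coe_one, one_mul, ← ENNReal.ofReal_sum_of_nonneg
        fun _ _ => pointNorm_nonneg _ _]
      exact ENNReal.ofReal_le_ofReal (pointNorm_homotopy_le hρ β I x)
    · rw [one_mul]
      gcongr
      refine (Finset.sum_le_sum fun j _ =>
        lintegral_value_le hp β (Fin.cons j I) (inter U I)).trans ?_
      simp
  refine (Finset.sum_le_sum fun I _ => h I).trans ?_
  simp [mul_assoc]

theorem exists_lpNorm_d_homotopy_le (r s : ℕ) {p : ℝ} (hp : 1 ≤ p) :
    ∃ C : ℝ≥0, ∀ β : K n r (s + 1) U,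
      (homotopy hρ β).d.lpNorm p ≤ C * (β.lpNorm p + β.d.lpNorm p) := by
  obtain ⟨C₀, hC₀⟩ := exists_measurable_equiv_pointNorm n M r
  obtain ⟨C₁, hC₁⟩ := exists_measurable_equiv_pointNorm n M (r + 1)
  obtain ⟨A, hA, hd⟩ := exists_pointNorm_d_homotopy_le hρ r s
  set C := max C₀ C₁
  refine ⟨Fintype.card (Fin s ↪o Fin N) * (A.toNNReal * C * N), fun β => ?_⟩
  have h : ∀ I : Fin s ↪o Fin N, Form.lpNorm p ((homotopy hρ β).d I) ≤
      (A.toNNReal * C : ℝ≥0) * (N * (β.lpNorm p + β.d.lpNorm p)) := by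
    intro I
    choose g hg hfg hgf using fun j : Fin N => hC₀ _ (β.component (Fin.cons j I))
    choose g' hg' hfg' hgf' using fun j : Fin N => hC₁ _ (β.d.component (Fin.cons j I))
    -- Minkowski is applied once to 2N functions, indexed by a sum type: the norms of the β_{jI} and
    -- of the (dβ)_{jI}.
    refine (lintegral_rpow_le_of_le_sum hp Finset.univ (A := A.toNNReal) (C := C)
      (g := Sum.elim g g')
      (f := Sum.elim (fun j x => ENNReal.ofReal (pointNorm x (β.value x (Fin.cons j I))))
        (fun j x => ENNReal.ofReal (pointNorm x (β.d.value x (Fin.cons j I)))))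
      (fun x => ?_) ?_ ?_ ?_).trans ?_
    · refine (ENNReal.ofReal_le_ofReal (hd x β I)).trans ?_
      rw [ENNReal.ofReal_mul hA, Fintype.sum_sum_type, Finset.sum_add_distrib,
        ENNReal.ofReal_add (Finset.sum_nonneg fun _ _ => pointNorm_nonneg _ _)
          (Finset.sum_nonneg fun _ _ => pointNorm_nonneg _ _),
        ENNReal.ofReal_sum_of_nonneg fun _ _ => pointNorm_nonneg _ _,
        ENNReal.ofReal_sum_of_nonneg fun _ _ => pointNorm_nonneg _ _]
      rfl
    · rintro (j | j) -
      exacts [hg j, hg' j]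
    · rintro (j | j) -
      exacts [hfg j, hfg' j]
    · rintro (j | j) - x
      · refine (hgf j x).trans ?_
        gcongr
        exacts [le_max_left _ _, le_rfl]
      · refine (hgf' j x).trans ?_
        gcongr
        exacts [le_max_right _ _, le_rfl]
    · gcongr
      rw [Fintype.sum_sum_type, mul_add]
      refine add_le_add ?_ ?_
      · refine (Finset.sum_le_sum fun j _ =>
          lintegral_value_le hp β (Fin.cons j I) (inter U I)).trans ?_
        simp
      · refine (Finset.sum_le_sum fun j _ =>
          lintegral_value_le hp β.d (Fin.cons j I) (inter U I)).trans ?_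
        simp
  refine (Finset.sum_le_sum fun I _ => h I).trans ?_
  simp [mul_assoc]

end Estimates

end CechForms

end

/-! ### The theorem -/

theorem proposition3p3 {n N : ℕ} {M : Type*} [TopologicalSpace M]
    [ChartedSpace (EuclideanSpace ℝ (Fin n)) M] [IsManifold (𝓡 n) ∞ M]
    [T2Space M] [CompactSpace M] [MeasurableSpace M] [BorelSpace M]
    [RiemannianBundle (fun x : M => TangentSpace (𝓡 n) x)]
    [IsContMDiffRiemannianBundle (𝓡 n) ∞ (EuclideanSpace ℝ (Fin n))
      (fun x : M => TangentSpace (𝓡 n) x)]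
    (U : Fin N → Opens M) (hU : ⋃ i, (U i : Set M) = univ) (r : ℕ) :
    -- `δ² = 0`
    (∀ s : ℕ, (CechForms.delta (n := n) U r (s + 1)).comp (CechForms.delta U r s) = 0) ∧
    -- exactness of `0 → K^{r,0} → K^{r,1} → K^{r,2} → ⋯`
    (Function.Injective (CechForms.delta (n := n) U r 0) ∧
      ∀ s : ℕ, Function.Exact (CechForms.delta (n := n) U r s)
        (CechForms.delta (n := n) U r (s + 1))) ∧
    -- primitives with estimates
    (∀ (s : ℕ) (p : ℝ), 1 ≤ p → ∃ C : ℝ≥0,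
      ∀ β : CechForms.K n r (s + 1) U, CechForms.delta U r (s + 1) β = 0 →
        ∃ α : CechForms.K n r s U, CechForms.delta U r s α = β ∧
          α.lpNorm p ≤ C * β.lpNorm p ∧
          α.d.lpNorm p ≤ C * (β.lpNorm p + β.d.lpNorm p)) ∧
    -- any smooth partition of unity subordinate to the cover yields such primitives
    (∀ ρ : SmoothPartitionOfUnity (Fin N) (𝓡 n) M univ,
      ρ.IsSubordinate (fun i => (U i : Set M)) →
      ∀ (s : ℕ) (p : ℝ), 1 ≤ p → ∃ C : ℝ≥0,
        ∀ β : CechForms.K n r (s + 1) U, CechForms.delta U r (s + 1) β = 0 →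
          ∃ α : CechForms.K n r s U,
            (∀ (I : Fin s ↪o Fin N) (x : CechForms.inter U I),
              (α I).1 x = ∑ j : Fin N,
                ρ j (x : M) • CechForms.extendZero (β.component (Fin.cons j I)).1 x) ∧
            CechForms.delta U r s α = β ∧
            α.lpNorm p ≤ C * β.lpNorm p ∧
            α.d.lpNorm p ≤ C * (β.lpNorm p + β.d.lpNorm p)) := by
  have estimates : ∀ ρ : SmoothPartitionOfUnity (Fin N) (𝓡 n) M univ,
      ∀ hρ : ρ.IsSubordinate (fun i => (U i : Set M)),
      ∀ (s : ℕ) (p : ℝ), 1 ≤ p → ∃ C : ℝ≥0, ∀ β : CechForms.K n r (s + 1) U,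
        (CechForms.homotopy hρ β).lpNorm p ≤ C * β.lpNorm p ∧
        (CechForms.homotopy hρ β).d.lpNorm p ≤ C * (β.lpNorm p + β.d.lpNorm p) := by
    intro ρ hρ s p hp
    obtain ⟨C₀, h₀⟩ := CechForms.exists_lpNorm_homotopy_le hρ r s hp
    obtain ⟨C₁, h₁⟩ := CechForms.exists_lpNorm_d_homotopy_le hρ r s hp
    refine ⟨max C₀ C₁, fun β => ⟨(h₀ β).trans ?_, (h₁ β).trans ?_⟩⟩
    · gcongr
      exact le_max_left _ _
    · gcongr
      exact le_max_right _ _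
  -- The covering hypothesis supplies a subordinate partition of unity, so exactness and part (ii)
  -- follow from the construction of part (iii).
  obtain ⟨ρ, hρ⟩ : ∃ ρ : SmoothPartitionOfUnity (Fin N) (𝓡 n) M univ,
      ρ.IsSubordinate (fun i => (U i : Set M)) :=
    SmoothPartitionOfUnity.exists_isSubordinate (𝓡 n) isClosed_univ _
      (fun i => (U i).isOpen) hU.ge
  refine ⟨CechForms.delta_comp_delta U r, ⟨CechForms.delta_injective hU, fun s β => ⟨fun hβ =>
    ⟨CechForms.homotopy hρ β, CechForms.delta_homotopy hρ hβ⟩, ?_⟩⟩, fun s p hp => ?_,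
    fun ρ' hρ' s p hp => ?_⟩
  · rintro ⟨α, rfl⟩
    exact LinearMap.congr_fun (CechForms.delta_comp_delta U r s) α
  · obtain ⟨C, hC⟩ := estimates ρ hρ s p hp
    exact ⟨C, fun β hβ => ⟨CechForms.homotopy hρ β, CechForms.delta_homotopy hρ hβ, hC β⟩⟩
  · obtain ⟨C, hC⟩ := estimates ρ' hρ' s p hp
    exact ⟨C, fun β hβ => ⟨CechForms.homotopy hρ' β, fun I x => rfl,
      CechForms.delta_homotopy hρ' hβ, hC β⟩⟩
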